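/- **Setting.** There are $K\ge 1$ Actors, a horizon $H\ge 1$, a finite set $\mathcal Z$ of latent variables, a measurable space $\mathcal S$ of physical states, measurable spaces $\mathcal A_k$ of low-level actions, a countable set $\mathcal O$ of observations, a set $\mathcal G=\mathcal G_1\times\dots\times\mathcal G_K$ of joint subgoals and a set $\Omega$ of tasks. Each $z\in\mathcal Z$ specifies Markov kernels $\mathbb T_{h,b}(\cdot\mid s,a)$ on $\mathcal S$ and a (possibly correlated) joint low-level policy $\mu_{h,b}(\cdot\mid s,\mathbf g)$ on $\mathcal A_1\times\dots\times\mathcal A_K$; running them for $H_a$ low-level steps from $s$ under the joint subgoal $\mathbf g$ gives the high-level transition kernel $\mathbb P_{z,h}(\cdot\mid s,\mathbf g)$. Further data, independent of $z$, are the law $\rho$ of $s_1$, translation distributions $\mathbb O_h(\cdot\mid s)$ on $\mathcal O$, and rewards $r_h(o,\omega)\in[0,1]$. Write $\tau_h=(o_1,\mathbf g_1,\dots,\mathbf g_{h-1},o_h)$. A policy is a product $\pi_h(\mathbf g\mid\tau_h,\omega)=\prod_{k=1}^K\pi_{h,k}(g_k\mid\tau_h,\omega)$ of discrete distributions; $\mathbb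 P^\pi_z$ is the law of the trajectory under $\pi$ and $z$, and $\mathcal J_z(\pi,\omega)=\mathbb E^\pi_z\big[\sum_{h=1}^H r_h(o_h,\omega)\big]$. Assume that for every $z$ a policy $\pi^*_z$ is given that maximizes $\mathcal J_z(\cdot,\omega)$ for every $\omega$. **Pretraining.** Under $\mathbb P_{\mathcal D}$ a latent $z\sim\mathcal P_{\mathcal Z}$ is drawn and then, independently given $z$, $T_{\rm p}$ episodes: a task $\omega\sim\mathcal P_\Omega$, a trajectory $\tau_H$ generated in environment $z$ by a behavior policy $\pi^b$, and labels $\mathbf g^{*}_h\sim\pi^*_{z,h}(\cdot\mid\tau_h,\omega)$, $h\in[H]$. A prompt $\mathtt{pt}^t_h$, with $t\in[T_{\rm p}]$ and $h\in[H]$, consists of the tasks and trajectories $(\omega^i,\tau^i_H)_{i<t}$ of the earlier episodes, the current task $\omega^t$ and the current trajectory $\tau^t_h$. In the perfect setting the Reporter reports with $\mathbb O$, and for every prompt with $\mathbb P_{\mathcal D}(\mathtt{pt}^t_h)>0$ the LLM, asked about Actor $k$, returns the distribution $\mathtt{LLM}(g\mid\mathtt{pt}^t_h,k)=\mathbb P_{\mathcal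 D}(g^{t,*}_{h,k}=g\mid\mathtt{pt}^t_h)$. **Planner.** Let $\varepsilon=\min\big\{1,\big(HK\log(c_{\mathcal Z}|\mathcal Z|\sqrt T)/(T\eta)\big)^{1/2}\big\}$. In each episode $t\in[T]$, on a task $\omega^t$, the Planner tosses an independent coin. With probability $\varepsilon$ it follows, throughout the episode, an exploration policy $\pi_{\mathtt{exp}}$ (which does not depend on the task). Otherwise it follows $\pi^t_{h,\mathtt{LLM}}(\mathbf g\mid\tau_h,\omega^t)=\prod_{k=1}^K\mathtt{LLM}(g_k\mid\mathtt{pt}^t_h,k)$, where the prompt contains the history $\mathcal H_t=(\omega^i,\tau^i_H)_{i<t}$ of its own earlier episodes. Let $\pi^t$ be the policy followed in episode $t$ and $$\mathrm{Reg}_z(T)=\sum_{t=1}^T\mathbb E\big[\mathcal J_z(\pi^*_z,\omega^t)-\mathcal J_z(\pi^t,\omega^t)\big],$$ where the expectation is over $\mathcal H_t$ and the coin, and the environment is $z$. **Corollary (multi-agent collaboration regret).** There are absolute constants $C$ and $p$ such that the following holds in the perfect setting, for all $1\le T\le T_{\rm p}$. Assume * $\mathcal P_{\mathcal Z}(z')/\mathcal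 P_{\mathcal Z}(z)\le c_{\mathcal Z}$ for all $z,z'\in\mathcal Z$ (so $\mathcal P_{\mathcal Z}(z)>0$); * $\pi_{\mathtt{exp}}$ is $\eta$-distinguishable: $\eta>0$ and $D^2_{\rm H}\big(\mathbb P^{\pi_{\mathtt{exp}}}_z(\tau_H),\mathbb P^{\pi_{\mathtt{exp}}}_{z'}(\tau_H)\big)\ge\eta$ for all $z\ne z'$, where $D^2_{\rm H}(P,Q)=\frac12\sum_x(\sqrt{P(x)}-\sqrt{Q(x)})^2$; * the prompts of the Planner can occur in pretraining: $\mathcal P_\Omega(\omega^t)>0$ for all $t\in[T]$, and $\pi^b_{h,k}(g\mid\tau_h,\omega)>0$ whenever $\pi_{\mathtt{exp},h,k}(g\mid\tau_h)>0$ or $\pi^*_{z,h,k}(g\mid\tau_h,\omega)>0$ for some $z$. Then, for every prompt with $\mathbb P_{\mathcal D}(\mathtt{pt}^t_h)>0$ and every $\mathbf g\in\mathcal G$, $$\prod_{k=1}^K\mathtt{LLM}(g_k\mid\mathtt{pt}^t_h,k)=\prod_{k=1}^K\Big(\sum_{z\in\mathcal Z}\pi^*_{z,h,k}(g_k\mid\tau^t_h,\omega^t)\,\mathbb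 P_{\mathcal D}(z\mid\mathtt{pt}^t_h)\Big),$$ and for every $z\in\mathcal Z$ $$\mathrm{Reg}_z(T)\le C\,H^{3/2}\sqrt{\frac{TK}{\eta}\log\big(c_{\mathcal Z}|\mathcal Z|\sqrt T\big)}\;(1+\log T)^p .$$ -/

import Mathlib

open MeasureTheory ProbabilityTheory
open scoped ENNReal

noncomputable section

namespace CoopHMG

/-- A trajectory `(o_1, g_1, …, o_n, g_n, o_{n+1})`: `n + 1` observations and `n` subgoals.
Steps are numbered from `0`, so `Traj O J h` is what the Planner knows when it acts at step `h`,
and a whole episode with horizon `H ≥ 1` gives a `Traj O J (H - 1)`. -/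
abbrev Traj (O J : Type*) (n : ℕ) : Type _ := (Fin (n + 1) → O) × (Fin n → J)

/-- The initial part of a trajectory, up to the observation at step `m`. -/
def Traj.take {O J : Type*} {n : ℕ} (τ : Traj O J n) (m : ℕ) (h : m ≤ n) : Traj O J m :=
  (fun i => τ.1 (Fin.castLE (Nat.succ_le_succ h) i), fun i => τ.2 (Fin.castLE h i))

/-- A cooperative hierarchical Markov game with `K` Actors. The latent variable `z : Z` stands for
the pair (low-level transition kernels, joint low-level policy of the Actors). The Actors may be
correlated, since `actor` is a kernel into joint actions. Physical states and actions live in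
arbitrary measurable spaces. -/
structure HMG (K : ℕ) (Z S : Type*) (A : Fin K → Type*) (O : Type*) (G : Fin K → Type*)
    (Ω : Type*) [MeasurableSpace S] [∀ k, MeasurableSpace (A k)] [MeasurableSpace O] where
  /-- number of low-level steps in one high-level step -/
  lowHorizon : ℕ
  /-- law of the initial state -/
  init : Measure S
  init_prob : IsProbabilityMeasure init
  /-- low-level transition at high-level step `h` and low-level step `b` -/
  lowTrans : Z → (h b : ℕ) → Kernel (S × (∀ k, A k)) S
  lowTrans_markov : ∀ z h b, IsMarkovKernel (lowTrans z h b)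
  /-- joint policy of the Actors under the joint subgoal `g` -/
  actor : Z → (h b : ℕ) → (g : ∀ k, G k) → Kernel S (∀ k, A k)
  actor_markov : ∀ z h b g, IsMarkovKernel (actor z h b g)
  /-- ground-truth translation distribution -/
  emission : (h : ℕ) → Kernel S O
  emission_markov : ∀ h, IsMarkovKernel (emission h)
  /-- shared reward, a function of observation and task -/
  reward : (h : ℕ) → O → Ω → ℝ
  reward_mem : ∀ h o ω, reward h o ω ∈ Set.Icc (0 : ℝ) 1

/-- A high-level policy. It is a family of policies `π_{h,k}` of the single agents, whose product is
the joint policy. -/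
abbrev Policy {K : ℕ} (O : Type*) (G : Fin K → Type*) (Ω : Type*) : Type _ :=
  (h : ℕ) → (k : Fin K) → Traj O (∀ k, G k) h → Ω → PMF (G k)

/-- An exploration policy does not look at the task. -/
abbrev ExpPolicy {K : ℕ} (O : Type*) (G : Fin K → Type*) : Type _ :=
  (h : ℕ) → (k : Fin K) → Traj O (∀ k, G k) h → PMF (G k)

section Model

variable {K : ℕ} {Z S : Type*} {A : Fin K → Type*} {O : Type*} {G : Fin K → Type*} {Ω : Type*}

/-- The joint probability `π_h(g | τ, ω) = ∏_k π_{h,k}(g_k | τ, ω)`. -/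
def Policy.joint (π : Policy O G Ω) (h : ℕ) (τ : Traj O (∀ k, G k) h) (ω : Ω) (g : ∀ k, G k) :
    ℝ≥0∞ :=
  ∏ k, π h k τ ω (g k)

/-- `π(τ)`: the part of the probability of `τ` that is due to the policy. -/
def Policy.mass (π : Policy O G Ω) (ω : Ω) {n : ℕ} (τ : Traj O (∀ k, G k) n) : ℝ≥0∞ :=
  ∏ i : Fin n, π.joint i (τ.take i i.isLt.le) ω (τ.2 i)

/-- An exploration policy, viewed as a policy. -/
def ExpPolicy.toPolicy (e : ExpPolicy O G) : Policy O G Ω := fun h k τ _ => e h k τ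

variable [MeasurableSpace S] [∀ k, MeasurableSpace (A k)] [MeasurableSpace O]

/-- One low-level step: the Actors draw a joint action, then the physical state moves. -/
def HMG.lowStep (M : HMG K Z S A O G Ω) (z : Z) (h b : ℕ) (g : ∀ k, G k) : Kernel S S :=
  (M.lowTrans z h b) ∘ₖ (Kernel.id ×ₖ M.actor z h b g)

/-- The law of the physical state after `n` low-level steps. -/
def HMG.lowIter (M : HMG K Z S A O G Ω) (z : Z) (h : ℕ) (g : ∀ k, G k) : ℕ → Kernel S S
  | 0 => Kernel.id
  | n + 1 => M.lowStep z h n g ∘ₖ M.lowIter z h g n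

/-- The high-level transition kernel `P_{z,h}(· | s, g)`: the law of the state at the end of a whole
low-level episode. -/
def HMG.trans (M : HMG K Z S A O G Ω) (z : Z) (h : ℕ) (g : ∀ k, G k) : Kernel S S :=
  M.lowIter z h g M.lowHorizon

/-- `M.forward em z τ B` is the probability that the observations are those of `τ` and that the
current state is in `B`, when the subgoals of `τ` are executed, the environment is `z`, and the
observations are reported through `em`. -/
def HMG.forward (M : HMG K Z S A O G Ω) (em : ℕ → Kernel S O) (z : Z) :
    (n : ℕ) → Traj O (∀ k, G k) n → Measure S
  | 0, τ => M.init.withDensity fun s => em 0 s {τ.1 0}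
  | n + 1, τ =>
      ((M.forward em z n (τ.take n n.le_succ)).bind (M.trans z n (τ.2 (Fin.last n)))).withDensity
        fun s => em (n + 1) s {τ.1 (Fin.last (n + 1))}

/-- `P_z(τ)`: the part of the probability of `τ` that is due to the environment. -/
def HMG.envMass (M : HMG K Z S A O G Ω) (em : ℕ → Kernel S O) (z : Z) {n : ℕ}
    (τ : Traj O (∀ k, G k) n) : ℝ≥0∞ :=
  M.forward em z n τ Set.univ

/-- `P_z^π(τ) = π(τ) · P_z(τ)`, the probability of the trajectory `τ` under `π` on task `ω`. -/
def HMG.trajMass (M : HMG K Z S A O G Ω) (em : ℕ → Kernel S O) (z : Z) (π : Policy O G Ω) (ω : Ω)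
    {n : ℕ} (τ : Traj O (∀ k, G k) n) : ℝ≥0∞ :=
  π.mass ω τ * M.envMass em z τ

/-- The value `J_z(π, ω) = E_π [∑_h r_h(o_h, ω)]` over `H` steps. -/
def HMG.value (M : HMG K Z S A O G Ω) (H : ℕ) (z : Z) (π : Policy O G Ω) (ω : Ω) : ℝ :=
  ∑' τ : Traj O (∀ k, G k) (H - 1), (M.trajMass M.emission z π ω τ).toReal *
    ∑ h : Fin H, M.reward h (τ.1 ⟨h, by omega⟩) ω

/-- `π z` is, for every latent variable and every task, an optimal policy. -/
def HMG.IsOptimal (M : HMG K Z S A O G Ω) (H : ℕ) (π : Z → Policy O G Ω) : Prop :=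
  ∀ z ω, ∀ π' : Policy O G Ω, M.value H z π' ω ≤ M.value H z (π z) ω

/-- The squared Hellinger distance of two probability mass functions. -/
def hellingerSq {X : Type*} (p q : X → ℝ≥0∞) : ℝ :=
  1 / 2 * ∑' x, (√(p x).toReal - √(q x).toReal) ^ 2

/-- The exploration policy is `η`-distinguishable: it tells any two latent variables apart, with
squared Hellinger distance at least `η` between the laws of the whole trajectory. As an exploration
policy ignores the task, the trivial task type `Unit` is used. -/
def HMG.Distinguishable (M : HMG K Z S A O G Ω) (H : ℕ) (e : ExpPolicy O G) (η : ℝ) : Prop :=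
  0 < η ∧ ∀ z z' : Z, z ≠ z' →
    η ≤ hellingerSq
      (fun τ : Traj O (∀ k, G k) (H - 1) =>
        (e.toPolicy : Policy O G Unit).mass () τ * M.envMass M.emission z τ)
      (fun τ : Traj O (∀ k, G k) (H - 1) =>
        (e.toPolicy : Policy O G Unit).mass () τ * M.envMass M.emission z' τ)

/-- What enters the pretraining distribution besides the game: the priors on latent variables and on
tasks, the experts `π*_z`, and the behavior policy `π^b`. -/
structure Pretraining {K : ℕ} (Z O : Type*) (G : Fin K → Type*) (Ω : Type*) where
  prior : PMF Z
  taskPrior : PMF Ω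
  expert : Z → Policy O G Ω
  behavior : Policy O G Ω

/-- One pretraining episode: the task, the trajectory, and the expert subgoals (labels) `g*_h`. -/
structure DataEpisode {K : ℕ} (H : ℕ) (O : Type*) (G : Fin K → Type*) (Ω : Type*) where
  task : Ω
  traj : Traj O (∀ k, G k) (H - 1)
  label : Fin H → (∀ k, G k)

/-- A prompt at step `h` of an episode that is preceded by `t` episodes: the earlier tasks and
trajectories, the current task, and the current trajectory. -/
structure Prompt {K : ℕ} (H : ℕ) (O : Type*) (G : Fin K → Type*) (Ω : Type*) (t h : ℕ) where
  past : Fin t → Ω × Traj O (∀ k, G k) (H - 1)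
  task : Ω
  traj : Traj O (∀ k, G k) h

/-- A data point: the latent variable and `Tp` episodes. -/
abbrev DataPoint {K : ℕ} (H Tp : ℕ) (Z O : Type*) (G : Fin K → Type*) (Ω : Type*) : Type _ :=
  Z × (Fin Tp → DataEpisode H O G Ω)

/-- The trajectory of an episode up to step `h`. -/
def DataEpisode.upTo {H : ℕ} (d : DataEpisode H O G Ω) (h : Fin H) : Traj O (∀ k, G k) h :=
  d.traj.take h (Nat.le_sub_one_of_lt h.isLt)

/-- The joint probability `P_𝒟` of a data point (with the physical states integrated out):
`𝒫_Z(z) ∏_t 𝒫_Ω(ω^t) ∏_h π*_{z,h}(g*_h | τ_h, ω^t) · π^b(τ^t) · P_z(τ^t)`. -/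
def Pretraining.dataMass (P : Pretraining Z O G Ω) (M : HMG K Z S A O G Ω) (H Tp : ℕ)
    (D : DataPoint H Tp Z O G Ω) : ℝ≥0∞ :=
  P.prior D.1 * ∏ t : Fin Tp,
    (P.taskPrior (D.2 t).task *
      (∏ h : Fin H, (P.expert D.1).joint h ((D.2 t).upTo h) (D.2 t).task ((D.2 t).label h)) *
      P.behavior.mass (D.2 t).task (D.2 t).traj * M.envMass M.emission D.1 (D.2 t).traj)

/-- `P_𝒟(E)`. -/
def Pretraining.prob (P : Pretraining Z O G Ω) (M : HMG K Z S A O G Ω) (H Tp : ℕ)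
    (E : Set (DataPoint H Tp Z O G Ω)) : ℝ≥0∞ :=
  ∑' D, E.indicator (P.dataMass M H Tp) D

/-- The conditional probability `P_𝒟(E | F)`, for events `F` of positive probability. -/
def Pretraining.condProb (P : Pretraining Z O G Ω) (M : HMG K Z S A O G Ω) (H Tp : ℕ)
    (E F : Set (DataPoint H Tp Z O G Ω)) : ℝ≥0∞ :=
  P.prob M H Tp (E ∩ F) / P.prob M H Tp F

/-- The event that a data point begins with the prompt `pt`. -/
def Prompt.event {H Tp : ℕ} {t : Fin Tp} {h : Fin H} (pt : Prompt H O G Ω t h) :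
    Set (DataPoint H Tp Z O G Ω) :=
  {D | (∀ i : Fin t, ((D.2 (Fin.castLE t.isLt.le i)).task, (D.2 (Fin.castLE t.isLt.le i)).traj) =
      pt.past i) ∧ (D.2 t).task = pt.task ∧ (D.2 t).upTo h = pt.traj}

/-- The event that, at episode `t` and step `h`, the expert subgoal for Actor `k` is `g`. -/
def labelEvent {H Tp : ℕ} (t : Fin Tp) (h : Fin H) (k : Fin K) (g : G k) :
    Set (DataPoint H Tp Z O G Ω) :=
  {D | (D.2 t).label h k = g}

/-- The event that the latent variable is `z`. -/
def latentEvent {H Tp : ℕ} (z : Z) : Set (DataPoint H Tp Z O G Ω) :=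
  {D | D.1 = z}

/-- A language model, as the Planner uses it: for a prompt and the index `k` of an Actor, a
distribution of the next subgoal of that Actor. -/
abbrev LanguageModel {K : ℕ} (H : ℕ) (O : Type*) (G : Fin K → Type*) (Ω : Type*) : Type _ :=
  (t h : ℕ) → Prompt H O G Ω t h → (k : Fin K) → PMF (G k)

/-- The perfect setting. The pretrained Reporter `rep` reports with the ground-truth translation
distribution, and on every prompt that the pretraining data contain with positive probability the
pretrained model `L` predicts with the conditional distribution under `P_𝒟`. -/
structure Perfect (P : Pretraining Z O G Ω) (M : HMG K Z S A O G Ω) (H Tp : ℕ)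
    (rep : ℕ → Kernel S O) (L : LanguageModel H O G Ω) : Prop where
  reporter : ∀ h < H, ∀ s, rep h s = M.emission h s
  model : ∀ (t : Fin Tp) (h : Fin H) (pt : Prompt H O G Ω t h),
    P.prob M H Tp pt.event ≠ 0 → ∀ (k : Fin K) (g : G k),
      L t h pt k g = P.condProb M H Tp (labelEvent t h k g) pt.event

/-- The recommended policy `π^t_LLM` in episode `t`, with the history `past` of trajectories on the
tasks `ω 0, …, ω (t - 1)`. Each Actor gets its own prompt. -/
def LanguageModel.recommend {H : ℕ} (L : LanguageModel H O G Ω) (ω : ℕ → Ω) (t : ℕ)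
    (past : Fin t → Traj O (∀ k, G k) (H - 1)) : Policy O G Ω :=
  fun h k τ w => L t h ⟨fun i => (ω i, past i), w, τ⟩ k

/-- The policy that the multi-agent Planner executes throughout episode `t`: the exploration policy
if the coin `I` of that episode says so, the recommended policy otherwise. -/
def plannerPolicy {H : ℕ} (L : LanguageModel H O G Ω) (e : ExpPolicy O G) (ω : ℕ → Ω) (t : ℕ)
    (past : Fin t → Traj O (∀ k, G k) (H - 1)) (I : Bool) : Policy O G Ω :=
  if I then e.toPolicy else L.recommend ω t past

/-- The Bernoulli weights of the coin: explore with probability `ε`. -/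
def coin (ε : ℝ) (I : Bool) : ℝ := if I then ε else 1 - ε

/-- The probability that the first `t` episodes of the multi-agent Planner have the trajectories
`past`, in the environment `z` with Reporter `rep`, for the task sequence `ω`. -/
def HMG.historyMass (M : HMG K Z S A O G Ω) (H : ℕ) (rep : ℕ → Kernel S O)
    (L : LanguageModel H O G Ω) (e : ExpPolicy O G) (ε : ℝ) (z : Z) (ω : ℕ → Ω) (t : ℕ)
    (past : Fin t → Traj O (∀ k, G k) (H - 1)) : ℝ≥0∞ :=
  ∏ i : Fin t, ∑ I : Bool, ENNReal.ofReal (coin ε I) *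
    M.trajMass rep z (plannerPolicy L e ω i (fun j => past (Fin.castLE i.isLt.le j)) I) (ω i)
      (past i)

/-- The regret `∑_t E[J_z(π*_z, ω^t) - J_z(π^t, ω^t)]` of the multi-agent Planner over `T` episodes.
The expectation is over the history and over the coin of episode `t`. -/
def HMG.regret (M : HMG K Z S A O G Ω) (H : ℕ) (opt : Z → Policy O G Ω) (rep : ℕ → Kernel S O)
    (L : LanguageModel H O G Ω) (e : ExpPolicy O G) (ε : ℝ) (z : Z) (ω : ℕ → Ω) (T : ℕ) : ℝ :=
  ∑ t ∈ Finset.range T, ∑' past : Fin t → Traj O (∀ k, G k) (H - 1),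
    (M.historyMass H rep L e ε z ω t past).toReal * ∑ I : Bool, coin ε I *
      (M.value H z (opt z) (ω t) - M.value H z (plannerPolicy L e ω t past I) (ω t))

/-- The behavior policy may play every subgoal that the exploration policy or an expert may play. -/
def Pretraining.Covers (P : Pretraining Z O G Ω) (e : ExpPolicy O G) : Prop :=
  ∀ h k τ ω (g : G k), (e h k τ g ≠ 0 ∨ ∃ z, P.expert z h k τ ω g ≠ 0) →
    P.behavior h k τ ω g ≠ 0

end Model

/-- The exploration probability `(H K log(c |Z| √T) / (T η))^{1/2}`, capped at `1`. -/
def exploreProb (H K T cardZ : ℕ) (c η : ℝ) : ℝ :=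
  min 1 ((H * K * Real.log (c * cardZ * √T) / (T * η)) ^ (1 / 2 : ℝ))

end CoopHMG
end

/-! In-context prediction is Bayesian averaging. Given `z` and the prompt, the label is drawn from
the expert of `z`, so the model returns the posterior mean of the experts
(`Pretraining.condProb_label`). Tasks and behavior policy contribute factors free of `z`, which
cancel in the posterior. It therefore depends only on the prior and the environment likelihoods, and
stays informative although the Planner's data come from another, adaptive policy.

Let `q` be the posterior weight of the true `z`. Each Actor's recommendation dominates `q` times the
expert, so by Bernoulli's inequality the joint gap is at most `K * (1 - q)`. Multiplied by the
likelihood of `z`, `1 - q` is at most `c` times the sum over `z' ≠ z` of the geometric mean of the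
likelihoods of `z` and `z'` (`envMass_mul_one_sub_posterior_le`). Summed over histories with the
Planner's policy weights, these are Bhattacharyya coefficients. They contract episode by episode
(`tsum_plannerMass_mul_geoMean_le`): exploring gives a factor at most `1 - η`, any other policy at
most `1`, hence `ε * (1 - η) + (1 - ε) = 1 - ε * η` on average. A telescoping argument over the
steps of an episode turns the gaps into a distance between trajectory laws, at most a multiple of
`(1 - ε * η) ^ t` (`Perfect.tsum_history_mul_gap_le`).

The model is constrained only on prompts of positive pretraining probability. Coverage shows, by
induction over steps and episodes, that all prompts which matter are of this kind.

Exploration costs at most `ε * H` per episode. Exploitation costs `H` times a sum of truncated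
geometric terms, of order `H * H * K * log (c * |Z|) / (ε * η)`. The chosen `ε` balances the two. -/

noncomputable section

namespace CoopHMG

/-! ### Sums of products, adaptive weights, Bhattacharyya coefficients -/

section Sums

/-- A sum over a finite dependent product of a product of functions factorizes. -/
theorem tsum_pi_prod : ∀ {n : ℕ} {X : Fin n → Type*} (f : ∀ i, X i → ℝ≥0∞),
    ∑' x : ∀ i, X i, ∏ i, f i (x i) = ∏ i, ∑' a, f i a := by
  intro n
  induction n with
  | zero => intro X f; simp
  | succ n ih =>
    intro X f
    rw [← (Fin.consEquiv X).tsum_eq, ENNReal.tsum_prod', Fin.prod_univ_succ,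
      ← ih fun i => f i.succ, ← ENNReal.tsum_mul_right]
    refine tsum_congr fun a => ?_
    rw [← ENNReal.tsum_mul_left]
    refine tsum_congr fun y => ?_
    simp [Fin.consEquiv, Fin.prod_univ_succ]

theorem tsum_snoc {X : Type*} {n : ℕ} (f : (Fin (n + 1) → X) → ℝ≥0∞) :
    ∑' x, f x = ∑' y : Fin n → X, ∑' a, f (Fin.snoc (α := fun _ => X) y a) := by
  rw [← (Fin.snocEquiv fun _ : Fin (n + 1) => X).tsum_eq, ENNReal.tsum_prod', ENNReal.tsum_comm]
  rfl

/-- Weights that are chosen adaptively, each of total mass at most `b`. -/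
theorem tsum_adaptive_le {X : Type*} (q : (t : ℕ) → (Fin t → X) → X → ℝ≥0∞) (b : ℝ≥0∞)
    (hq : ∀ t past, ∑' x, q t past x ≤ b) (t : ℕ) :
    ∑' past : Fin t → X, ∏ i : Fin t, q i (fun j => past (Fin.castLE i.isLt.le j)) (past i) ≤
      b ^ t := by
  induction t with
  | zero => simp
  | succ t ih =>
    rw [tsum_snoc, pow_succ]
    refine le_trans ?_ (mul_le_mul_left ih b)
    rw [← ENNReal.tsum_mul_right]
    refine ENNReal.tsum_le_tsum fun y => ?_
    refine le_trans (le_of_eq ?_) (mul_le_mul_right (hq t y) _)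
    rw [← ENNReal.tsum_mul_left]
    refine tsum_congr fun a => ?_
    rw [Fin.prod_univ_castSucc]
    have key : ∀ (i : Fin t) (j : Fin i),
        Fin.snoc (α := fun _ => X) y a (Fin.castLE (Fin.castSucc i).isLt.le j) =
          y (Fin.castLE i.isLt.le j) := fun i j =>
      Fin.snoc_castSucc (α := fun _ => X) a y (Fin.castLE i.isLt.le j)
    have key' : ∀ j : Fin t,
        Fin.snoc (α := fun _ => X) y a (Fin.castLE (Fin.last t).isLt.le j) = y j := fun j =>
      Fin.snoc_castSucc (α := fun _ => X) a y j
    congr 1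
    · refine Finset.prod_congr rfl fun i _ => ?_
      rw [Fin.snoc_castSucc]
      exact congrArg (fun p => q i p (y i)) (funext (key i))
    · rw [Fin.snoc_last]
      exact congrArg (fun p => q t p a) (funext key')

/-- For pretraining episodes: those after the current one are unconstrained and have total mass one.
-/
theorem prod_eq_prod_initial {n : ℕ} (t : Fin n) (f : Fin n → ℝ≥0∞)
    (hf : ∀ i, t < i → f i = 1) :
    ∏ i, f i = (∏ i : Fin t, f (Fin.castLE t.isLt.le i)) * f t := by
  obtain ⟨t, ht⟩ := t
  obtain ⟨r, rfl⟩ : ∃ r, n = t + 1 + r := ⟨n - (t + 1), by omega⟩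
  rw [Fin.prod_univ_add, Finset.prod_eq_one (s := Finset.univ) (f := fun i : Fin r => _), mul_one,
    Fin.prod_univ_castSucc]
  · rfl
  · intro i _
    exact hf _ (by simp [Fin.lt_def]; omega)

/-- The geometric mean `√(a b)`. -/
def geoMean (a b : ℝ≥0∞) : ℝ≥0∞ := a ^ (1 / 2 : ℝ) * b ^ (1 / 2 : ℝ)

theorem geoMean_self (a : ℝ≥0∞) : geoMean a a = a := by
  rw [geoMean, ← ENNReal.rpow_add_of_nonneg _ _ (by norm_num) (by norm_num)]
  norm_num

theorem geoMean_mono {a b a' b' : ℝ≥0∞} (ha : a ≤ a') (hb : b ≤ b') :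
    geoMean a b ≤ geoMean a' b' := by
  unfold geoMean
  gcongr

theorem geoMean_mul (a b a' b' : ℝ≥0∞) :
    geoMean (a * a') (b * b') = geoMean a b * geoMean a' b' := by
  simp only [geoMean, ENNReal.mul_rpow_of_nonneg _ _ (show (0 : ℝ) ≤ 1 / 2 by norm_num)]
  ring

theorem geoMean_prod {ι : Type*} (s : Finset ι) (f g : ι → ℝ≥0∞) :
    geoMean (∏ i ∈ s, f i) (∏ i ∈ s, g i) = ∏ i ∈ s, geoMean (f i) (g i) := by
  classical
  induction s using Finset.induction_on with
  | empty => simp [geoMean]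
  | insert a s ha ih => rw [Finset.prod_insert ha, Finset.prod_insert ha, geoMean_mul, ih,
      Finset.prod_insert ha]

theorem geoMean_le (a b : ℝ≥0∞) : geoMean a b ≤ a / 2 + b / 2 := by
  have h := ENNReal.young_inequality (a ^ (1 / 2 : ℝ)) (b ^ (1 / 2 : ℝ))
    (show Real.HolderConjugate 2 2 from Real.HolderConjugate.two_two)
  rw [← ENNReal.rpow_mul, ← ENNReal.rpow_mul] at h
  norm_num at h
  simpa [geoMean] using h

theorem tsum_geoMean_le_one {X : Type*} (p q : X → ℝ≥0∞) (hp : ∑' x, p x = 1)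
    (hq : ∑' x, q x = 1) : ∑' x, geoMean (p x) (q x) ≤ 1 := by
  refine (ENNReal.tsum_le_tsum fun x => geoMean_le (p x) (q x)).trans (le_of_eq ?_)
  rw [ENNReal.tsum_add]
  simp only [div_eq_mul_inv, ENNReal.tsum_mul_right, hp, hq, one_mul, ENNReal.inv_two_add_inv_two]

/-- The Bhattacharyya coefficient in terms of the squared Hellinger distance. -/
theorem tsum_geoMean_le {X : Type*} (p q : X → ℝ≥0∞) (hp : ∑' x, p x = 1)
    (hq : ∑' x, q x = 1) :
    ∑' x, geoMean (p x) (q x) ≤ ENNReal.ofReal (1 - hellingerSq p q) := by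
  have sp : Summable fun x => (p x).toReal := ENNReal.summable_toReal (by simp [hp])
  have sq : Summable fun x => (q x).toReal := ENNReal.summable_toReal (by simp [hq])
  have fp : ∀ x, p x ≠ ∞ := ENNReal.ne_top_of_tsum_ne_top (by simp [hp])
  have fq : ∀ x, q x ≠ ∞ := ENNReal.ne_top_of_tsum_ne_top (by simp [hq])
  have tp : ∑' x, (p x).toReal = 1 := by rw [← ENNReal.tsum_toReal_eq fp, hp]; simp
  have tq : ∑' x, (q x).toReal = 1 := by rw [← ENNReal.tsum_toReal_eq fq, hq]; simp
  have htop : ∑' x, geoMean (p x) (q x) ≠ ∞ :=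
    ne_top_of_le_ne_top ENNReal.one_ne_top (tsum_geoMean_le_one p q hp hq)
  have hr : ∀ x, (geoMean (p x) (q x)).toReal =
      √(p x).toReal * √(q x).toReal := fun x => by
    rw [geoMean, ENNReal.toReal_mul, ← ENNReal.toReal_rpow, ← ENNReal.toReal_rpow, Real.sqrt_eq_rpow,
      Real.sqrt_eq_rpow]
  have sr : Summable fun x => √(p x).toReal * √(q x).toReal := by
    simpa only [hr] using ENNReal.summable_toReal htop
  rw [← ENNReal.ofReal_toReal htop]
  refine ENNReal.ofReal_le_ofReal (le_of_eq ?_)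
  rw [ENNReal.tsum_toReal_eq (ENNReal.ne_top_of_tsum_ne_top htop)]
  simp only [hr, hellingerSq]
  have hx : ∀ x, (√(p x).toReal - √(q x).toReal) ^ 2 =
      (p x).toReal + (q x).toReal - 2 * (√(p x).toReal * √(q x).toReal) := fun x => by
    have h1 := Real.sq_sqrt (ENNReal.toReal_nonneg (a := p x))
    have h2 := Real.sq_sqrt (ENNReal.toReal_nonneg (a := q x))
    linear_combination h1 + h2
  simp only [hx]
  rw [(sp.add sq).tsum_sub (sr.mul_left 2), sp.tsum_add sq, tp, tq, tsum_mul_left]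
  ring

/-- Bernoulli's inequality for `q ≤ 1`. -/
theorem one_le_pow_add_mul_one_sub (q : ℝ≥0∞) (hq : q ≤ 1) (n : ℕ) :
    1 ≤ q ^ n + n * (1 - q) := by
  induction n with
  | zero => simp
  | succ n ih =>
    calc (1 : ℝ≥0∞) ≤ q * 1 + (1 - q) := by rw [mul_one]; exact le_add_tsub
      _ ≤ q * (q ^ n + n * (1 - q)) + (1 - q) := by gcongr
      _ = q ^ (n + 1) + q * (n * (1 - q)) + (1 - q) := by ring
      _ ≤ q ^ (n + 1) + 1 * (n * (1 - q)) + (1 - q) := by gcongr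
      _ = q ^ (n + 1) + (n + 1 : ℕ) * (1 - q) := by push_cast; ring

end Sums

/-! ### Trajectory laws: policy factor times environment factor -/

section Trajectories

variable {K : ℕ} {Z S : Type*} {A : Fin K → Type*} {O J : Type*} {G : Fin K → Type*} {Ω : Type*}

/-- Append a subgoal and the next observation. -/
def Traj.snoc {n : ℕ} (τ : Traj O J n) (g : J) (o : O) : Traj O J (n + 1) :=
  (Fin.snoc (α := fun _ => O) τ.1 o, Fin.snoc (α := fun _ => J) τ.2 g)

theorem Traj.take_snoc {n m : ℕ} (τ : Traj O J n) (g : J) (o : O) (h : m ≤ n) :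
    (τ.snoc g o).take m (h.trans n.le_succ) = τ.take m h := by
  refine Prod.ext (funext fun i => ?_) (funext fun i => ?_)
  · exact Fin.snoc_castSucc (α := fun _ => O) o τ.1 (Fin.castLE (Nat.succ_le_succ h) i)
  · exact Fin.snoc_castSucc (α := fun _ => J) g τ.2 (Fin.castLE h i)

theorem Traj.exists_eq_snoc {n : ℕ} (τ : Traj O J (n + 1)) :
    ∃ (σ : Traj O J n) (g : J) (o : O), τ = σ.snoc g o :=
  ⟨τ.take n n.le_succ, τ.2 (Fin.last n), τ.1 (Fin.last (n + 1)),
    Prod.ext (Fin.snoc_init_self (α := fun _ => O) τ.1).symm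
      (Fin.snoc_init_self (α := fun _ => J) τ.2).symm⟩

theorem Traj.tsum_succ {n : ℕ} (f : Traj O J (n + 1) → ℝ≥0∞) :
    ∑' τ, f τ = ∑' τ : Traj O J n, ∑' g, ∑' o, f (τ.snoc g o) := by
  rw [ENNReal.tsum_prod', tsum_snoc]
  simp_rw [tsum_snoc (X := J)]
  rw [ENNReal.tsum_prod']
  refine tsum_congr fun x => ?_
  rw [ENNReal.tsum_comm]
  refine tsum_congr fun y => ?_
  rw [ENNReal.tsum_comm]
  rfl

theorem Policy.tsum_joint (π : Policy O G Ω) (h : ℕ) (τ : Traj O (∀ k, G k) h) (ω : Ω) :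
    ∑' g, π.joint h τ ω g = 1 := by
  unfold Policy.joint
  rw [tsum_pi_prod fun k => π h k τ ω]
  simp [PMF.tsum_coe]

/-- The marginals of the joint policy. -/
theorem Policy.tsum_indicator_joint (π : Policy O G Ω) (h : ℕ) (τ : Traj O (∀ k, G k) h) (ω : Ω)
    (k : Fin K) (a : G k) :
    ∑' g, {g : ∀ k, G k | g k = a}.indicator (π.joint h τ ω) g = π h k τ ω a := by
  classical
  -- The indicator of an event in coordinate `k` becomes a product over all coordinates: for `i ≠ k`
  -- the condition is vacuous.
  let f : ∀ i, G i → ℝ≥0∞ := fun i x => if ∀ e : i = k, e ▸ x = a then π h i τ ω x else 0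
  have hf : ∀ g : ∀ k, G k, {g : ∀ k, G k | g k = a}.indicator (π.joint h τ ω) g =
      ∏ i, f i (g i) := by
    intro g
    by_cases hg : g k = a
    · rw [Set.indicator_of_mem (by exact hg)]
      refine Finset.prod_congr rfl fun i _ => ?_
      exact (if_pos (by rintro rfl; exact hg)).symm
    · rw [Set.indicator_of_notMem (by exact hg)]
      refine (Finset.prod_eq_zero (Finset.mem_univ k) (if_neg ?_)).symm
      exact fun h => hg (h rfl)
  simp only [hf]
  rw [tsum_pi_prod, Finset.prod_eq_single k]
  · rw [tsum_eq_single a]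
    · simp [f]
    · intro b hb
      simp [f, hb]
  · intro i _ hi
    simp [f, hi, PMF.tsum_coe]
  · simp

theorem Policy.joint_le_one (π : Policy O G Ω) (h : ℕ) (τ : Traj O (∀ k, G k) h) (ω : Ω)
    (g : ∀ k, G k) : π.joint h τ ω g ≤ 1 :=
  Finset.prod_le_one' fun _ _ => PMF.coe_le_one _ _

theorem Policy.mass_le_one (π : Policy O G Ω) (ω : Ω) {n : ℕ} (τ : Traj O (∀ k, G k) n) :
    π.mass ω τ ≤ 1 :=
  Finset.prod_le_one' fun _ _ => π.joint_le_one _ _ _ _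

theorem Policy.mass_zero (π : Policy O G Ω) (ω : Ω) (τ : Traj O (∀ k, G k) 0) :
    π.mass ω τ = 1 := by
  simp [Policy.mass]

theorem Policy.mass_snoc (π : Policy O G Ω) (ω : Ω) {n : ℕ} (τ : Traj O (∀ k, G k) n)
    (g : ∀ k, G k) (o : O) : π.mass ω (τ.snoc g o) = π.mass ω τ * π.joint n τ ω g := by
  unfold Policy.mass
  rw [Fin.prod_univ_castSucc]
  congr 1
  · refine Finset.prod_congr rfl fun i _ => ?_
    have h1 : (τ.snoc g o).take (Fin.castSucc i : Fin (n + 1)) (Fin.castSucc i).isLt.le =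
      τ.take i i.isLt.le := Traj.take_snoc τ g o i.isLt.le
    have h2 : (τ.snoc g o).2 (Fin.castSucc i) = τ.2 i :=
      Fin.snoc_castSucc (α := fun _ => ∀ k, G k) g τ.2 i
    rw [h2]
    exact congrArg (fun σ => π.joint i σ ω (τ.2 i)) h1
  · have h1 : (τ.snoc g o).take (Fin.last n) (Fin.last n).isLt.le = τ :=
      Traj.take_snoc τ g o le_rfl
    have h2 : (τ.snoc g o).2 (Fin.last n) = g := Fin.snoc_last (α := fun _ => ∀ k, G k) g τ.2
    rw [h2]
    exact congrArg (fun σ => π.joint n σ ω g) h1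

variable [MeasurableSpace S] [∀ k, MeasurableSpace (A k)] [MeasurableSpace O]

attribute [instance] HMG.init_prob HMG.lowTrans_markov HMG.actor_markov HMG.emission_markov

instance HMG.lowStep_markov (M : HMG K Z S A O G Ω) (z : Z) (h b : ℕ) (g : ∀ k, G k) :
    IsMarkovKernel (M.lowStep z h b g) := by
  unfold HMG.lowStep; infer_instance

instance HMG.lowIter_markov (M : HMG K Z S A O G Ω) (z : Z) (h : ℕ) (g : ∀ k, G k) (n : ℕ) :
    IsMarkovKernel (M.lowIter z h g n) := by
  induction n with
  | zero => unfold HMG.lowIter; infer_instance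
  | succ n ih => unfold HMG.lowIter; infer_instance

instance HMG.trans_markov (M : HMG K Z S A O G Ω) (z : Z) (h : ℕ) (g : ∀ k, G k) :
    IsMarkovKernel (M.trans z h g) := by
  unfold HMG.trans; infer_instance

/-- The part of the trajectory mass due to the environment depends only on the first `H` steps of
the reporter. -/
theorem HMG.forward_congr (M : HMG K Z S A O G Ω) {em em' : ℕ → Kernel S O} {H : ℕ}
    (h : ∀ i < H, ∀ s, em i s = em' i s) (z : Z) {n : ℕ} (hn : n < H)
    (τ : Traj O (∀ k, G k) n) : M.forward em z n τ = M.forward em' z n τ := by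
  induction n with
  | zero => simp only [HMG.forward, h 0 hn]
  | succ n ih => simp only [HMG.forward, h (n + 1) hn, ih (by omega)]

theorem HMG.trajMass_congr (M : HMG K Z S A O G Ω) {em em' : ℕ → Kernel S O} {H : ℕ}
    (h : ∀ i < H, ∀ s, em i s = em' i s) (z : Z) (π : Policy O G Ω) (ω : Ω) {n : ℕ} (hn : n < H)
    (τ : Traj O (∀ k, G k) n) : M.trajMass em z π ω τ = M.trajMass em' z π ω τ := by
  simp only [HMG.trajMass, HMG.envMass, M.forward_congr h z hn]

variable [Countable O] [MeasurableSingletonClass O]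

theorem tsum_lintegral_singleton (κ : Kernel S O) [IsMarkovKernel κ] (μ : Measure S) :
    ∑' o, ∫⁻ s, κ s {o} ∂μ = μ Set.univ := by
  rw [← lintegral_tsum fun o => (κ.measurable_coe (measurableSet_singleton o)).aemeasurable]
  have : ∀ s, ∑' o, κ s {o} = 1 := fun s => by
    have h := lintegral_countable' (μ := κ s) (fun _ : O => 1)
    simpa using h.symm
  simp [this]

theorem HMG.tsum_envMass_zero (M : HMG K Z S A O G Ω) (z : Z) :
    ∑' τ : Traj O (∀ k, G k) 0, M.envMass M.emission z τ = 1 := by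
  have h : ∀ τ : Traj O (∀ k, G k) 0, M.envMass M.emission z τ =
      ∫⁻ s, M.emission 0 s {τ.1 0} ∂M.init := fun τ => by
    simp [HMG.envMass, HMG.forward, withDensity_apply]
  simp only [h]
  rw [ENNReal.tsum_prod (f := fun (x : Fin 1 → O) (_ : Fin 0 → ∀ k, G k) =>
    ∫⁻ s, M.emission 0 s {x 0} ∂M.init)]
  rw [← (Equiv.funUnique (Fin 1) O).symm.tsum_eq]
  simp [tsum_lintegral_singleton]

theorem HMG.tsum_envMass_snoc (M : HMG K Z S A O G Ω) (z : Z) {n : ℕ}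
    (τ : Traj O (∀ k, G k) n) (g : ∀ k, G k) :
    ∑' o, M.envMass M.emission z (τ.snoc g o) = M.envMass M.emission z τ := by
  have h : ∀ o, M.envMass M.emission z (τ.snoc g o) =
      ∫⁻ s, M.emission (n + 1) s {o} ∂((M.forward M.emission z n τ).bind (M.trans z n g)) := by
    intro o
    have h1 : (τ.snoc g o).1 (Fin.last (n + 1)) = o := Fin.snoc_last (α := fun _ => O) o τ.1
    have h2 : (τ.snoc g o).2 (Fin.last n) = g := Fin.snoc_last (α := fun _ => ∀ k, G k) g τ.2
    have h3 : (τ.snoc g o).take n n.le_succ = τ := Traj.take_snoc τ g o le_rfl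
    simp only [HMG.envMass, HMG.forward, h1, h2, h3, withDensity_apply _ MeasurableSet.univ,
      Measure.restrict_univ]
  simp only [h]
  rw [tsum_lintegral_singleton, Measure.bind_apply MeasurableSet.univ (Kernel.aemeasurable _)]
  simp [HMG.envMass]

/-- Marginalization of the trajectory distribution. -/
theorem HMG.tsum_mass_mul_envMass_take (M : HMG K Z S A O G Ω) (z : Z) (π : Policy O G Ω) (ω : Ω)
    {m n : ℕ} (hmn : m ≤ n) (F : Traj O (∀ k, G k) m → ℝ≥0∞) :
    ∑' τ : Traj O (∀ k, G k) n, π.mass ω τ * M.envMass M.emission z τ * F (τ.take m hmn) =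
      ∑' τ : Traj O (∀ k, G k) m, π.mass ω τ * M.envMass M.emission z τ * F τ := by
  induction n, hmn using Nat.le_induction with
  | base => rfl
  | succ n hmn ih =>
    rw [Traj.tsum_succ, ← ih]
    refine tsum_congr fun τ => ?_
    -- The last observation is summed out before the last subgoal; both laws are normalized, and `F`
    -- sees neither.
    simp_rw [Traj.take_snoc τ _ _ hmn, Policy.mass_snoc, ENNReal.tsum_mul_right,
      ENNReal.tsum_mul_left, M.tsum_envMass_snoc, ENNReal.tsum_mul_right, ENNReal.tsum_mul_left,
      π.tsum_joint, mul_one]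

theorem HMG.tsum_mass_mul_envMass (M : HMG K Z S A O G Ω) (z : Z) (π : Policy O G Ω) (ω : Ω)
    (n : ℕ) : ∑' τ : Traj O (∀ k, G k) n, π.mass ω τ * M.envMass M.emission z τ = 1 := by
  have h := M.tsum_mass_mul_envMass_take z π ω n.zero_le fun _ => 1
  simpa [Policy.mass_zero, M.tsum_envMass_zero] using h

theorem HMG.envMass_snoc_le (M : HMG K Z S A O G Ω) (z : Z) {n : ℕ} (τ : Traj O (∀ k, G k) n)
    (g : ∀ k, G k) (o : O) :
    M.envMass M.emission z (τ.snoc g o) ≤ M.envMass M.emission z τ :=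
  (ENNReal.le_tsum (f := fun o => M.envMass M.emission z (τ.snoc g o)) o).trans
    (M.tsum_envMass_snoc z τ g).le

theorem HMG.envMass_le_one (M : HMG K Z S A O G Ω) (z : Z) {n : ℕ} (τ : Traj O (∀ k, G k) n) :
    M.envMass M.emission z τ ≤ 1 := by
  induction n with
  | zero => exact (ENNReal.le_tsum τ).trans (M.tsum_envMass_zero z).le
  | succ n ih =>
    obtain ⟨σ, g, o, rfl⟩ := τ.exists_eq_snoc
    exact (M.envMass_snoc_le z σ g o).trans (ih σ)

end Trajectories

/-! ### Pretraining: prompt probabilities and the posterior -/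

section Prompts

variable {K : ℕ} {Z S : Type*} {A : Fin K → Type*} {O : Type*} {G : Fin K → Type*} {Ω : Type*}

/-- Given the trajectory the labels are independent, so all but the one at `h` sum to one. -/
theorem tsum_indicator_label {H : ℕ} {J : Type*} (p : Fin H → J → ℝ≥0∞)
    (hp : ∀ i, ∑' g, p i g = 1) (h : Fin H) (E : Set J) :
    ∑' l : Fin H → J, {l : Fin H → J | l h ∈ E}.indicator (fun l => ∏ i, p i (l i)) l =
      ∑' g, E.indicator (p h) g := by
  classical
  have hl : ∀ l : Fin H → J, {l : Fin H → J | l h ∈ E}.indicator (fun l => ∏ i, p i (l i)) l =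
      ∏ i, if i = h → l i ∈ E then p i (l i) else 0 := by
    intro l
    by_cases hE : l h ∈ E
    · rw [Set.indicator_of_mem (by exact hE)]
      exact Finset.prod_congr rfl fun i _ => (if_pos (by rintro rfl; exact hE)).symm
    · rw [Set.indicator_of_notMem (by exact hE)]
      exact (Finset.prod_eq_zero (Finset.mem_univ h) (if_neg fun hh => hE (hh rfl))).symm
  simp only [hl]
  rw [tsum_pi_prod fun i g => if i = h → g ∈ E then p i g else 0, Finset.prod_eq_single h]
  · exact tsum_congr fun g => by simp [Set.indicator_apply]
  · intro i _ hi
    simp [hi, hp]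
  · simp

theorem DataEpisode.tsum_eq {H : ℕ} (f : DataEpisode H O G Ω → ℝ≥0∞) :
    ∑' d, f d = ∑' w, ∑' τ, ∑' l, f ⟨w, τ, l⟩ := by
  let E : Ω × Traj O (∀ k, G k) (H - 1) × (Fin H → ∀ k, G k) ≃ DataEpisode H O G Ω :=
    { toFun := fun x => ⟨x.1, x.2.1, x.2.2⟩
      invFun := fun d => (d.task, d.traj, d.label)
      left_inv := fun _ => rfl
      right_inv := fun _ => rfl }
  rw [← E.tsum_eq, ENNReal.tsum_prod']
  exact tsum_congr fun w => ENNReal.tsum_prod'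

variable [MeasurableSpace S] [∀ k, MeasurableSpace (A k)] [MeasurableSpace O]

/-- The probability of one pretraining episode in environment `z`. -/
def Pretraining.episodeMass (P : Pretraining Z O G Ω) (M : HMG K Z S A O G Ω) {H : ℕ} (z : Z)
    (d : DataEpisode H O G Ω) : ℝ≥0∞ :=
  P.taskPrior d.task * (∏ h : Fin H, (P.expert z).joint h (d.upTo h) d.task (d.label h)) *
    P.behavior.mass d.task d.traj * M.envMass M.emission z d.traj

/-- The probability of the task and the trajectory in environment `z`, with the labels summed
out. -/
def Pretraining.taskTrajMass (P : Pretraining Z O G Ω) (M : HMG K Z S A O G Ω) (z : Z) (w : Ω)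
    {n : ℕ} (τ : Traj O (∀ k, G k) n) : ℝ≥0∞ :=
  P.taskPrior w * (P.behavior.mass w τ * M.envMass M.emission z τ)

theorem Pretraining.tsum_label (P : Pretraining Z O G Ω) (M : HMG K Z S A O G Ω) {H : ℕ} (z : Z)
    (w : Ω) (τ : Traj O (∀ k, G k) (H - 1)) :
    ∑' l : Fin H → ∀ k, G k, P.episodeMass M z ⟨w, τ, l⟩ = P.taskTrajMass M z w τ := by
  simp only [Pretraining.episodeMass, DataEpisode.upTo, ENNReal.tsum_mul_right,
    ENNReal.tsum_mul_left]
  rw [tsum_pi_prod fun (i : Fin H) => (P.expert z).joint i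
    (τ.take i (Nat.le_sub_one_of_lt i.isLt)) w]
  simp only [Policy.tsum_joint, Finset.prod_const_one, mul_one, Pretraining.taskTrajMass, mul_assoc]

theorem Pretraining.tsum_episodeMass_past (P : Pretraining Z O G Ω) (M : HMG K Z S A O G Ω)
    {H : ℕ} (z : Z) (x : Ω × Traj O (∀ k, G k) (H - 1)) :
    ∑' d : DataEpisode H O G Ω, {d : DataEpisode H O G Ω | (d.task, d.traj) = x}.indicator
      (P.episodeMass M z) d = P.taskTrajMass M z x.1 x.2 := by
  classical
  rw [DataEpisode.tsum_eq, tsum_eq_single x.1, tsum_eq_single x.2, ← P.tsum_label]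
  · simp
  · intro τ hτ
    refine ENNReal.tsum_eq_zero.2 fun l => Set.indicator_of_notMem ?_ _
    exact fun h => hτ (congrArg Prod.snd h)
  · intro w hw
    simp [Prod.ext_iff, hw]

theorem Pretraining.prob_eq_sum_latent [Fintype Z] (P : Pretraining Z O G Ω)
    (M : HMG K Z S A O G Ω) {H Tp : ℕ} (F : Set (DataPoint H Tp Z O G Ω)) :
    P.prob M H Tp F = ∑ z, P.prob M H Tp (F ∩ latentEvent z) := by
  classical
  simp only [Pretraining.prob]
  rw [← tsum_fintype (L := .unconditional _), ENNReal.tsum_comm]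
  refine tsum_congr fun D => ?_
  rw [tsum_eq_single D.1]
  · by_cases hD : D ∈ F
    · rw [Set.indicator_of_mem hD, Set.indicator_of_mem (show D ∈ F ∩ latentEvent D.1 from
        ⟨hD, rfl⟩)]
    · rw [Set.indicator_of_notMem hD, Set.indicator_of_notMem fun h => hD h.1]
  · intro z hz
    exact Set.indicator_of_notMem (fun h => hz h.2.symm) _

variable [Countable O] [MeasurableSingletonClass O]

theorem Pretraining.tsum_episodeMass (P : Pretraining Z O G Ω) (M : HMG K Z S A O G Ω) {H : ℕ}
    (z : Z) : ∑' d : DataEpisode H O G Ω, P.episodeMass M z d = 1 := by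
  rw [DataEpisode.tsum_eq]
  simp only [P.tsum_label, Pretraining.taskTrajMass, ENNReal.tsum_mul_left,
    M.tsum_mass_mul_envMass, mul_one, PMF.tsum_coe]

/-- The conditional independence behind the posterior mean: given `z`, the label at `h` depends only
on the task and the trajectory up to `h`. The other labels and the rest of the trajectory are
marginalized. -/
theorem Pretraining.tsum_episodeMass_current (P : Pretraining Z O G Ω) (M : HMG K Z S A O G Ω)
    {H : ℕ} (z : Z) (h : Fin H) (w : Ω) (τ : Traj O (∀ k, G k) h) (E : Set (∀ k, G k)) :
    ∑' d : DataEpisode H O G Ω,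
      {d : DataEpisode H O G Ω | d.task = w ∧ d.upTo h = τ ∧ d.label h ∈ E}.indicator
        (P.episodeMass M z) d =
      (∑' g, E.indicator ((P.expert z).joint h τ w) g) * P.taskTrajMass M z w τ := by
  classical
  rw [DataEpisode.tsum_eq, tsum_eq_single w]
  · let F : Traj O (∀ k, G k) h → ℝ≥0∞ := fun σ =>
      if σ = τ then ∑' g, E.indicator ((P.expert z).joint h σ w) g else 0
    have hF : ∀ σ : Traj O (∀ k, G k) (H - 1), ∑' l,
        {d : DataEpisode H O G Ω | d.task = w ∧ d.upTo h = τ ∧ d.label h ∈ E}.indicator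
          (P.episodeMass M z) ⟨w, σ, l⟩ = P.taskPrior w * (P.behavior.mass w σ *
            M.envMass M.emission z σ * F (σ.take h (Nat.le_sub_one_of_lt h.isLt))) := by
      intro σ
      by_cases hσ : σ.take h (Nat.le_sub_one_of_lt h.isLt) = τ
      · have hl : ∀ l : Fin H → ∀ k, G k,
            {d : DataEpisode H O G Ω | d.task = w ∧ d.upTo h = τ ∧ d.label h ∈ E}.indicator
              (P.episodeMass M z) ⟨w, σ, l⟩ = P.taskPrior w * (P.behavior.mass w σ *
            M.envMass M.emission z σ) * {l : Fin H → ∀ k, G k | l h ∈ E}.indicator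
              (fun l => ∏ i : Fin H, (P.expert z).joint i
                (σ.take i (Nat.le_sub_one_of_lt i.isLt)) w (l i)) l := by
          intro l
          simp only [Set.indicator_apply, Set.mem_ofPred_eq, DataEpisode.upTo, hσ, true_and,
            mul_ite, mul_zero, Pretraining.episodeMass]
          split_ifs
          · ring
          · rfl
        simp only [hl, ENNReal.tsum_mul_left]
        rw [tsum_indicator_label (fun (i : Fin H) => (P.expert z).joint i
                (σ.take i (Nat.le_sub_one_of_lt i.isLt)) w) fun i => Policy.tsum_joint _ _ _ _]
        simp only [F, hσ, if_true]
        ring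
      · simp [Set.indicator_apply, DataEpisode.upTo, F, hσ]
    simp only [hF, ENNReal.tsum_mul_left]
    rw [M.tsum_mass_mul_envMass_take z P.behavior w _ F, tsum_eq_single τ]
    · simp only [F, if_true, Pretraining.taskTrajMass]
      ring
    · intro σ hσ
      simp [F, hσ]
  · intro w' hw
    simp [hw]

/-- The probability that the latent variable is `z` and that the prompt is `pt`. -/
def Pretraining.promptMass (P : Pretraining Z O G Ω) (M : HMG K Z S A O G Ω) {H t h : ℕ} (z : Z)
    (pt : Prompt H O G Ω t h) : ℝ≥0∞ :=
  P.prior z * ((∏ i : Fin t, P.taskTrajMass M z (pt.past i).1 (pt.past i).2) *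
    P.taskTrajMass M z pt.task pt.traj)

/-- Given `z` the episodes are independent and the event is a conjunction of one condition `C i` per
episode, so the sum factorizes. A general `E` serves both the labels of one Actor and, with `E =
Set.univ`, the prompt alone. -/
theorem Pretraining.prob_label_prompt_latent (P : Pretraining Z O G Ω) (M : HMG K Z S A O G Ω)
    {H Tp : ℕ} {t : Fin Tp} {h : Fin H} (pt : Prompt H O G Ω t h) (z : Z)
    (E : Set (∀ k, G k)) :
    P.prob M H Tp ({D | (D.2 t).label h ∈ E} ∩ pt.event ∩ latentEvent z) =
      (∑' g, E.indicator ((P.expert z).joint h pt.traj pt.task) g) * P.promptMass M z pt := by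
  classical
  let C : Fin Tp → Set (DataEpisode H O G Ω) := fun i =>
    {d | (∀ hi : i < t, (d.task, d.traj) = pt.past ⟨i, hi⟩) ∧
      (i = t → d.task = pt.task ∧ d.upTo h = pt.traj ∧ d.label h ∈ E)}
  have hC : ∀ f : Fin Tp → DataEpisode H O G Ω,
      ((z, f) : DataPoint H Tp Z O G Ω) ∈
        ({D | (D.2 t).label h ∈ E} ∩ pt.event ∩ latentEvent z : Set (DataPoint H Tp Z O G Ω)) ↔
      ∀ i, f i ∈ C i := by
    intro f
    constructor
    · rintro ⟨⟨h1, h2, h3, h4⟩, -⟩ i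
      exact ⟨fun hi => h2 ⟨i, hi⟩, by rintro rfl; exact ⟨h3, h4, h1⟩⟩
    · intro hf
      obtain ⟨h3, h4, h1⟩ := (hf t).2 rfl
      exact ⟨⟨h1, fun i => (hf (Fin.castLE t.isLt.le i)).1 i.isLt, h3, h4⟩, rfl⟩
  have hprod : ∀ f : Fin Tp → DataEpisode H O G Ω,
      ({D | (D.2 t).label h ∈ E} ∩ pt.event ∩ latentEvent z : Set (DataPoint H Tp Z O G Ω)).indicator
        (P.dataMass M H Tp) (z, f) = P.prior z * ∏ i, (C i).indicator (P.episodeMass M z) (f i) := by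
    intro f
    by_cases hf : ∀ i, f i ∈ C i
    · rw [Set.indicator_of_mem ((hC f).2 hf)]
      have h1 : ∀ i, (C i).indicator (P.episodeMass M z) (f i) = P.episodeMass M z (f i) :=
        fun i => Set.indicator_of_mem (hf i) _
      simp only [h1]
      rfl
    · rw [Set.indicator_of_notMem (mt (hC f).1 hf)]
      obtain ⟨i, hi⟩ := not_forall.1 hf
      rw [Finset.prod_eq_zero (Finset.mem_univ i) (Set.indicator_of_notMem hi _), mul_zero]
  rw [Pretraining.prob, ENNReal.tsum_prod', tsum_eq_single z]
  · simp only [hprod, ENNReal.tsum_mul_left]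
    rw [tsum_pi_prod, prod_eq_prod_initial t]
    · have ht : C t = {d | d.task = pt.task ∧ d.upTo h = pt.traj ∧ d.label h ∈ E} := by
        ext d; simp [C]
      have hi : ∀ i : Fin t, C (Fin.castLE t.isLt.le i) =
          {d | (d.task, d.traj) = pt.past i} := by
        intro i
        have h1 : Fin.castLE t.isLt.le i < t := i.isLt
        ext d
        exact ⟨fun hd => hd.1 h1, fun hd => ⟨fun _ => hd, fun e => absurd e h1.ne⟩⟩
      simp only [ht, hi, P.tsum_episodeMass_past, P.tsum_episodeMass_current,
        Pretraining.promptMass]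
      ring
    · intro i hi
      have : C i = Set.univ := by
        ext d
        simp [C, hi.not_gt, hi.ne']
      rw [this, Set.indicator_univ, P.tsum_episodeMass]
  · intro z' hz
    refine ENNReal.tsum_eq_zero.2 fun f => Set.indicator_of_notMem ?_ _
    exact fun hf => hz hf.2

theorem Pretraining.prob_prompt_latent (P : Pretraining Z O G Ω) (M : HMG K Z S A O G Ω)
    {H Tp : ℕ} {t : Fin Tp} {h : Fin H} (pt : Prompt H O G Ω t h) (z : Z) :
    P.prob M H Tp (pt.event ∩ latentEvent z) = P.promptMass M z pt := by
  have := P.prob_label_prompt_latent M pt z Set.univ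
  simpa [Policy.tsum_joint] using this

theorem Pretraining.prob_prompt [Fintype Z] (P : Pretraining Z O G Ω) (M : HMG K Z S A O G Ω)
    {H Tp : ℕ} {t : Fin Tp} {h : Fin H} (pt : Prompt H O G Ω t h) :
    P.prob M H Tp pt.event = ∑ z, P.promptMass M z pt := by
  simp only [P.prob_eq_sum_latent M pt.event, P.prob_prompt_latent]

/-- The posterior distribution of the latent variable. -/
theorem Pretraining.condProb_latent (P : Pretraining Z O G Ω) (M : HMG K Z S A O G Ω)
    {H Tp : ℕ} {t : Fin Tp} {h : Fin H} (pt : Prompt H O G Ω t h) (z : Z) :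
    P.condProb M H Tp (latentEvent z) pt.event =
      P.promptMass M z pt / P.prob M H Tp pt.event := by
  rw [Pretraining.condProb, Set.inter_comm, P.prob_prompt_latent]

/-- The expert label is predicted by averaging the experts over the posterior distribution. -/
theorem Pretraining.condProb_label [Fintype Z] (P : Pretraining Z O G Ω) (M : HMG K Z S A O G Ω)
    {H Tp : ℕ} {t : Fin Tp} {h : Fin H} (pt : Prompt H O G Ω t h) (k : Fin K) (g : G k) :
    P.condProb M H Tp (labelEvent t h k g) pt.event =
      ∑ z, P.expert z h k pt.traj pt.task g * P.condProb M H Tp (latentEvent z) pt.event := by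
  have h1 : ∀ z, P.prob M H Tp (labelEvent t h k g ∩ pt.event ∩ latentEvent z) =
      P.expert z h k pt.traj pt.task g * P.promptMass M z pt := fun z => by
    rw [← Policy.tsum_indicator_joint, ← P.prob_label_prompt_latent]
    rfl
  rw [Pretraining.condProb, P.prob_eq_sum_latent]
  simp only [h1, P.condProb_latent, div_eq_mul_inv, Finset.sum_mul, mul_assoc]

theorem Pretraining.taskTrajMass_ne_top (P : Pretraining Z O G Ω) (M : HMG K Z S A O G Ω) (z : Z)
    (w : Ω) {n : ℕ} (τ : Traj O (∀ k, G k) n) : P.taskTrajMass M z w τ ≠ ∞ :=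
  ENNReal.mul_ne_top (PMF.apply_ne_top _ _) (ENNReal.mul_ne_top
    (ne_top_of_le_ne_top ENNReal.one_ne_top (Policy.mass_le_one _ _ _))
    (ne_top_of_le_ne_top ENNReal.one_ne_top (M.envMass_le_one _ _)))

theorem Pretraining.promptMass_ne_top (P : Pretraining Z O G Ω) (M : HMG K Z S A O G Ω)
    {H t h : ℕ} (z : Z) (pt : Prompt H O G Ω t h) : P.promptMass M z pt ≠ ∞ :=
  ENNReal.mul_ne_top (PMF.apply_ne_top _ _) (ENNReal.mul_ne_top
    (ENNReal.prod_ne_top fun _ _ => P.taskTrajMass_ne_top M z _ _) (P.taskTrajMass_ne_top M z _ _))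

end Prompts

/-! ### The Planner's history, contraction of likelihoods, performance difference -/

section Planner

variable {K : ℕ} {Z S : Type*} {A : Fin K → Type*} {O : Type*} {G : Fin K → Type*} {Ω : Type*}
  [MeasurableSpace S] [∀ k, MeasurableSpace (A k)] [MeasurableSpace O]

/-- The probability that the Planner's policy in episode `t` assigns to the subgoals of `τ`. -/
def plannerMass {H : ℕ} (L : LanguageModel H O G Ω) (e : ExpPolicy O G) (ε : ℝ) (ω : ℕ → Ω)
    (t : ℕ) (past : Fin t → Traj O (∀ k, G k) (H - 1)) (τ : Traj O (∀ k, G k) (H - 1)) : ℝ≥0∞ :=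
  ∑ I : Bool, ENNReal.ofReal (coin ε I) * (plannerPolicy L e ω t past I).mass (ω t) τ

/-- The coin and the history act only on the policy factor. With the environment factor split off,
the same policy weights can be kept while the likelihood of `z` is replaced by a geometric mean. -/
theorem HMG.historyMass_eq (M : HMG K Z S A O G Ω) {H : ℕ} (hH : 1 ≤ H) {rep : ℕ → Kernel S O}
    (hrep : ∀ h < H, ∀ s, rep h s = M.emission h s)
    (L : LanguageModel H O G Ω) (e : ExpPolicy O G) (ε : ℝ) (z : Z) (ω : ℕ → Ω) (t : ℕ)
    (past : Fin t → Traj O (∀ k, G k) (H - 1)) :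
    M.historyMass H rep L e ε z ω t past =
      ∏ i : Fin t, plannerMass L e ε ω i (fun j => past (Fin.castLE i.isLt.le j)) (past i) *
        M.envMass M.emission z (past i) := by
  refine Finset.prod_congr rfl fun i _ => ?_
  rw [plannerMass, Finset.sum_mul]
  refine Finset.sum_congr rfl fun I _ => ?_
  rw [M.trajMass_congr hrep z _ _ (by omega), HMG.trajMass, mul_assoc]

theorem ofReal_coin_add {ε : ℝ} (h0 : 0 ≤ ε) (h1 : ε ≤ 1) :
    ENNReal.ofReal ε + ENNReal.ofReal (1 - ε) = 1 := by
  rw [← ENNReal.ofReal_add h0 (by linarith)]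
  simp

variable [Countable O] [MeasurableSingletonClass O]

theorem tsum_plannerMass_mul_envMass (M : HMG K Z S A O G Ω) {H : ℕ} (L : LanguageModel H O G Ω)
    (e : ExpPolicy O G) {ε : ℝ} (h0 : 0 ≤ ε) (h1 : ε ≤ 1) (z : Z) (ω : ℕ → Ω) (t : ℕ)
    (past : Fin t → Traj O (∀ k, G k) (H - 1)) :
    ∑' τ, plannerMass L e ε ω t past τ * M.envMass M.emission z τ = 1 := by
  simp only [plannerMass, Fintype.sum_bool, add_mul, mul_assoc, ENNReal.tsum_add,
    ENNReal.tsum_mul_left, M.tsum_mass_mul_envMass, coin, if_true, mul_one]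
  exact ofReal_coin_add h0 h1

theorem HMG.tsum_historyMass_le_one (M : HMG K Z S A O G Ω) {H : ℕ} (hH : 1 ≤ H)
    {rep : ℕ → Kernel S O} (hrep : ∀ h < H, ∀ s, rep h s = M.emission h s)
    (L : LanguageModel H O G Ω) (e : ExpPolicy O G) {ε : ℝ} (h0 : 0 ≤ ε) (h1 : ε ≤ 1) (z : Z)
    (ω : ℕ → Ω) (t : ℕ) : ∑' past, M.historyMass H rep L e ε z ω t past ≤ 1 := by
  simp only [M.historyMass_eq hH hrep]
  have := tsum_adaptive_le (fun t past τ => plannerMass L e ε ω t past τ * M.envMass M.emission z τ)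
    1 (fun t past => (tsum_plannerMass_mul_envMass M L e h0 h1 z ω t past).le) t
  simpa using this

/-- Both environments share the policy factor, which passes through the geometric mean; what remains
is the Bhattacharyya coefficient of two probability laws. -/
theorem HMG.tsum_mass_mul_geoMean_le_one (M : HMG K Z S A O G Ω) (z z' : Z) (π : Policy O G Ω)
    (w : Ω) (n : ℕ) : ∑' τ : Traj O (∀ k, G k) n,
      π.mass w τ * geoMean (M.envMass M.emission z τ) (M.envMass M.emission z' τ) ≤ 1 := by
  have := tsum_geoMean_le_one _ _ (M.tsum_mass_mul_envMass z π w n)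
    (M.tsum_mass_mul_envMass z' π w n)
  simpa only [geoMean_mul, geoMean_self] using this

theorem HMG.Distinguishable.tsum_mul_geoMean_le {M : HMG K Z S A O G Ω} {H : ℕ} {e : ExpPolicy O G} {η : ℝ}
    (hη : M.Distinguishable H e η) (w : Ω) {z z' : Z} (hz : z ≠ z') :
    ∑' τ : Traj O (∀ k, G k) (H - 1), (e.toPolicy : Policy O G Ω).mass w τ *
      geoMean (M.envMass M.emission z τ) (M.envMass M.emission z' τ) ≤ ENNReal.ofReal (1 - η) := by
  have := tsum_geoMean_le _ _ (M.tsum_mass_mul_envMass z (e.toPolicy : Policy O G Ω) w (H - 1))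
    (M.tsum_mass_mul_envMass z' (e.toPolicy : Policy O G Ω) w (H - 1))
  simp only [geoMean_mul, geoMean_self] at this
  -- The task `w` and the `Unit` task of `Distinguishable` give definitionally equal masses, since
  -- `toPolicy` ignores the task.
  exact this.trans (ENNReal.ofReal_le_ofReal (sub_le_sub_left (hη.2 z z' hz) 1))

theorem hellingerSq_le_one {X : Type*} (p q : X → ℝ≥0∞) (hp : ∑' x, p x = 1)
    (hq : ∑' x, q x = 1) : hellingerSq p q ≤ 1 := by
  have sp : Summable fun x => (p x).toReal := ENNReal.summable_toReal (by simp [hp])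
  have sq : Summable fun x => (q x).toReal := ENNReal.summable_toReal (by simp [hq])
  have tp : ∑' x, (p x).toReal = 1 := by
    rw [← ENNReal.tsum_toReal_eq (ENNReal.ne_top_of_tsum_ne_top (by simp [hp])), hp]; simp
  have tq : ∑' x, (q x).toReal = 1 := by
    rw [← ENNReal.tsum_toReal_eq (ENNReal.ne_top_of_tsum_ne_top (by simp [hq])), hq]; simp
  have hle : ∀ x, (√(p x).toReal - √(q x).toReal) ^ 2 ≤ (p x).toReal + (q x).toReal := fun x => by
    have h1 := Real.sq_sqrt (ENNReal.toReal_nonneg (a := p x))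
    have h2 := Real.sq_sqrt (ENNReal.toReal_nonneg (a := q x))
    nlinarith [mul_nonneg (Real.sqrt_nonneg (p x).toReal) (Real.sqrt_nonneg (q x).toReal)]
  have := (Summable.of_nonneg_of_le (fun x => sq_nonneg _) hle (sp.add sq)).tsum_le_tsum hle
    (sp.add sq)
  rw [sp.tsum_add sq, tp, tq] at this
  unfold hellingerSq
  linarith

/-- Keeps `1 - ε * η` nonnegative, so that `ENNReal.ofReal` does not truncate it. Two distinct
latent variables are needed: otherwise `η` is unconstrained from above. -/
theorem HMG.Distinguishable.eta_le_one {M : HMG K Z S A O G Ω} {H : ℕ} {e : ExpPolicy O G} {η : ℝ}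
    (hη : M.Distinguishable H e η) (w : Ω) {z z' : Z} (hz : z ≠ z') : η ≤ 1 :=
  (hη.2 z z' hz).trans (hellingerSq_le_one _ _
    (M.tsum_mass_mul_envMass z (e.toPolicy : Policy O G Ω) w (H - 1))
    (M.tsum_mass_mul_envMass z' (e.toPolicy : Policy O G Ω) w (H - 1)))

/-- Every episode of the Planner reduces the Bhattacharyya coefficient by the factor `1 - ε η`. -/
theorem tsum_plannerMass_mul_geoMean_le {M : HMG K Z S A O G Ω} {H : ℕ} {e : ExpPolicy O G} {η : ℝ}
    (hη : M.Distinguishable H e η) (hη1 : η ≤ 1) (L : LanguageModel H O G Ω) {ε : ℝ} (h0 : 0 ≤ ε)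
    (h1 : ε ≤ 1) (ω : ℕ → Ω) {z z' : Z} (hz : z ≠ z') (t : ℕ)
    (past : Fin t → Traj O (∀ k, G k) (H - 1)) :
    ∑' τ, plannerMass L e ε ω t past τ *
      geoMean (M.envMass M.emission z τ) (M.envMass M.emission z' τ) ≤
        ENNReal.ofReal (1 - ε * η) := by
  simp only [plannerMass, Fintype.sum_bool, add_mul, mul_assoc, ENNReal.tsum_add,
    ENNReal.tsum_mul_left, coin, if_true, plannerPolicy]
  refine (add_le_add (mul_le_mul_right (hη.tsum_mul_geoMean_le (ω t) hz) _)
    (mul_le_mul_right (M.tsum_mass_mul_geoMean_le_one z z' _ _ _) _)).trans (le_of_eq ?_)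
  simp only [Bool.false_eq_true, if_false, mul_one]
  rw [← ENNReal.ofReal_mul h0, ← ENNReal.ofReal_add (by nlinarith) (by linarith)]
  congr 1
  ring

/-- Performance difference: two policies are as far apart as the joint subgoals they draw. -/
theorem HMG.tsum_envMass_mul_tsub_le (M : HMG K Z S A O G Ω) (z : Z) (π π' : Policy O G Ω) (w : Ω)
    (n : ℕ) : ∑' τ : Traj O (∀ k, G k) n, M.envMass M.emission z τ * (π.mass w τ - π'.mass w τ) ≤
      ∑ h ∈ Finset.range n, ∑' τ : Traj O (∀ k, G k) h,
        π'.mass w τ * M.envMass M.emission z τ * ∑' g, (π.joint h τ w g - π'.joint h τ w g) := by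
  induction n with
  | zero => simp [Policy.mass_zero]
  | succ n ih =>
    rw [Finset.sum_range_succ, Traj.tsum_succ]
    refine le_trans ?_ (add_le_add ih le_rfl)
    rw [← ENNReal.tsum_add]
    refine ENNReal.tsum_le_tsum fun τ => ?_
    simp only [Policy.mass_snoc, ENNReal.tsum_mul_right, M.tsum_envMass_snoc,
      ENNReal.tsum_mul_left]
    rw [mul_comm (π'.mass w τ), mul_assoc, ← mul_add]
    refine mul_le_mul_right ?_ _
    -- Telescoping with truncated subtraction: either the pasts differ and the next subgoal follows
    -- `π`, or the past follows `π'` and the next subgoals differ.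
    calc ∑' g, (π.mass w τ * π.joint n τ w g - π'.mass w τ * π'.joint n τ w g)
        ≤ ∑' g, ((π.mass w τ - π'.mass w τ) * π.joint n τ w g +
            π'.mass w τ * (π.joint n τ w g - π'.joint n τ w g)) := by
          refine ENNReal.tsum_le_tsum fun g => tsub_le_iff_right.2 ?_
          calc π.mass w τ * π.joint n τ w g
              ≤ ((π.mass w τ - π'.mass w τ) + π'.mass w τ) * π.joint n τ w g := by
                gcongr; exact le_tsub_add
            _ ≤ (π.mass w τ - π'.mass w τ) * π.joint n τ w g + π'.mass w τ *
                ((π.joint n τ w g - π'.joint n τ w g) + π'.joint n τ w g) := by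
                rw [add_mul]; gcongr; exact le_tsub_add
            _ = _ := by ring
      _ = _ := by
          rw [ENNReal.tsum_add, ENNReal.tsum_mul_left, ENNReal.tsum_mul_left, π.tsum_joint, mul_one]

theorem HMG.tsum_envMass_mul_tsub_le_one (M : HMG K Z S A O G Ω) (z : Z) (π π' : Policy O G Ω)
    (w : Ω) (n : ℕ) :
    ∑' τ : Traj O (∀ k, G k) n, M.envMass M.emission z τ * (π.mass w τ - π'.mass w τ) ≤ 1 := by
  refine (ENNReal.tsum_le_tsum fun τ => ?_).trans (M.tsum_mass_mul_envMass z π w n).le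
  rw [mul_comm]
  gcongr
  exact tsub_le_self

/-- The return lies in `[0, H]`, so only the positive part of the difference of the laws matters;
truncated subtraction computes exactly that. Only `H - 1` subgoals enter, as the last one affects no
reward. -/
theorem HMG.value_sub_value_le (M : HMG K Z S A O G Ω) {H : ℕ} (hH : 1 ≤ H) (z : Z)
    (π π' : Policy O G Ω) (w : Ω) :
    M.value H z π w - M.value H z π' w ≤ H * (∑' τ : Traj O (∀ k, G k) (H - 1),
      M.envMass M.emission z τ * (π.mass w τ - π'.mass w τ)).toReal := by
  let R : Traj O (∀ k, G k) (H - 1) → ℝ := fun τ => ∑ h : Fin H, M.reward h (τ.1 ⟨h, by omega⟩) w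
  have hR0 : ∀ τ, 0 ≤ R τ := fun τ => Finset.sum_nonneg fun h _ => (M.reward_mem _ _ _).1
  have hR1 : ∀ τ, R τ ≤ H := fun τ => by
    have := Finset.sum_le_card_nsmul Finset.univ
      (fun h : Fin H => M.reward h (τ.1 ⟨h, by omega⟩) w) 1 fun h _ => (M.reward_mem _ _ _).2
    simpa using this
  have hs : ∀ π : Policy O G Ω,
      Summable fun τ : Traj O (∀ k, G k) (H - 1) => (M.trajMass M.emission z π w τ).toReal * R τ := by
    intro π
    have h1 : Summable fun τ : Traj O (∀ k, G k) (H - 1) =>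
        (M.trajMass M.emission z π w τ).toReal :=
      ENNReal.summable_toReal (by simp [HMG.trajMass, M.tsum_mass_mul_envMass])
    exact Summable.of_nonneg_of_le (fun τ => mul_nonneg ENNReal.toReal_nonneg (hR0 τ))
      (fun τ => mul_le_mul_of_nonneg_left (hR1 τ) ENNReal.toReal_nonneg) (h1.mul_right (H : ℝ))
  have htop : ∑' τ : Traj O (∀ k, G k) (H - 1),
      M.envMass M.emission z τ * (π.mass w τ - π'.mass w τ) ≠ ∞ :=
    ne_top_of_le_ne_top ENNReal.one_ne_top (M.tsum_envMass_mul_tsub_le_one z π π' w _)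
  have hv : ∀ π, M.value H z π w = ∑' τ, (M.trajMass M.emission z π w τ).toReal * R τ :=
    fun _ => rfl
  rw [hv, hv, ← (hs π).tsum_sub (hs π'),
    ENNReal.tsum_toReal_eq (ENNReal.ne_top_of_tsum_ne_top htop), ← tsum_mul_left]
  refine ((hs π).sub (hs π')).tsum_le_tsum (fun τ => ?_)
    ((ENNReal.summable_toReal htop).mul_left _)
  have hW : M.envMass M.emission z τ ≠ ∞ :=
    ne_top_of_le_ne_top ENNReal.one_ne_top (M.envMass_le_one z τ)
  have hm : π'.mass w τ ≠ ∞ := ne_top_of_le_ne_top ENNReal.one_ne_top (π'.mass_le_one w τ)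
  have h1 : (M.trajMass M.emission z π w τ).toReal - (M.trajMass M.emission z π' w τ).toReal ≤
      (M.envMass M.emission z τ * (π.mass w τ - π'.mass w τ)).toReal := by
    rw [ENNReal.mul_sub fun _ _ => hW]
    simp only [HMG.trajMass, mul_comm _ (M.envMass M.emission z τ)]
    exact ENNReal.le_toReal_sub (ENNReal.mul_ne_top hW hm)
  calc _ = ((M.trajMass M.emission z π w τ).toReal - (M.trajMass M.emission z π' w τ).toReal) *
        R τ := by ring
    _ ≤ (M.envMass M.emission z τ * (π.mass w τ - π'.mass w τ)).toReal * R τ :=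
        mul_le_mul_of_nonneg_right h1 (hR0 τ)
    _ ≤ (M.envMass M.emission z τ * (π.mass w τ - π'.mass w τ)).toReal * H :=
        mul_le_mul_of_nonneg_left (hR1 τ) ENNReal.toReal_nonneg
    _ = _ := mul_comm _ _

end Planner

/-! ### From the posterior to the gap between expert and recommendation -/

section Regret

variable {K : ℕ} {Z S : Type*} {A : Fin K → Type*} {O : Type*} {G : Fin K → Type*} {Ω : Type*}

/-- The posterior probability of the wrong latent variables is controlled by the square roots of
their likelihood ratios. -/
theorem envMass_mul_one_sub_posterior_le [Fintype Z] [DecidableEq Z] {p v : Z → ℝ≥0∞} {B c : ℝ≥0∞}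
    (hc : 1 ≤ c) (hp : ∀ z z', p z' ≤ c * p z) (hS0 : ∑ y, p y * (B * v y) ≠ 0)
    (hS : ∑ y, p y * (B * v y) ≠ ∞) (z : Z) :
    v z * (1 - p z * (B * v z) / ∑ y, p y * (B * v y)) ≤
      ∑ z' ∈ Finset.univ.erase z, c * geoMean (v z) (v z') := by
  set s := ∑ y, p y * (B * v y) with hs
  have h1 : 1 - p z * (B * v z) / s ≤
      ∑ z' ∈ Finset.univ.erase z, p z' * (B * v z') / s := by
    rw [tsub_le_iff_left, Finset.add_sum_erase Finset.univ (fun y => p y * (B * v y) / s)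
      (Finset.mem_univ z)]
    simp only [div_eq_mul_inv, ← Finset.sum_mul, ← hs]
    exact (ENNReal.mul_inv_cancel hS0 hS).ge
  refine (mul_le_mul_right h1 _).trans ?_
  rw [Finset.mul_sum]
  refine Finset.sum_le_sum fun z' _ => ?_
  rw [← mul_div_assoc]
  refine ENNReal.div_le_of_le_mul ?_
  have hsy : ∀ y, p y * (B * v y) ≤ s := fun y =>
    Finset.single_le_sum (f := fun y => p y * (B * v y)) (fun _ _ => zero_le) (Finset.mem_univ y)
  -- The normalizer dominates the geometric mean of any two of its terms. Dividing by it thus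
  -- cancels one factor `geoMean (v z) (v z')` of `v z * v z'` and leaves the other.
  have h2 : geoMean (p z * (B * v z)) (p z' * (B * v z')) ≤ s :=
    (geoMean_mono (hsy z) (hsy z')).trans (geoMean_self s).le
  have h3 : p z' ≤ c * geoMean (p z) (p z') := by
    calc p z' = geoMean (p z') (p z') := (geoMean_self _).symm
      _ ≤ geoMean (c * p z) (c * p z') :=
          geoMean_mono (hp z z') (le_mul_of_one_le_left zero_le hc)
      _ = c * geoMean (p z) (p z') := by rw [geoMean_mul, geoMean_self]
  have h4 : v z * v z' = geoMean (v z) (v z') * geoMean (v z) (v z') := by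
    conv_lhs => rw [← geoMean_self (v z), ← geoMean_self (v z')]
    simp only [geoMean]
    ring
  calc v z * (p z' * (B * v z')) = p z' * B * (v z * v z') := by ring
    _ ≤ c * geoMean (p z) (p z') * B * (v z * v z') := by gcongr
    _ = c * geoMean (v z) (v z') * geoMean (p z * (B * v z)) (p z' * (B * v z')) := by
        rw [geoMean_mul, geoMean_mul, geoMean_self, h4]; ring
    _ ≤ _ := by gcongr

/-- At a null `z` the ratio with a latent variable of positive prior would be `∞`. -/
theorem Pretraining.prior_ne_zero (P : Pretraining Z O G Ω) {c : ℝ}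
    (hc : ∀ z z' : Z, P.prior z' / P.prior z ≤ ENNReal.ofReal c) (z : Z) : P.prior z ≠ 0 := by
  obtain ⟨z', hz'⟩ := P.prior.support_nonempty
  intro h
  have := hc z z'
  rw [h, ENNReal.div_zero ((PMF.mem_support_iff _ _).1 hz')] at this
  exact absurd this (by simp)

theorem Pretraining.one_le_of_prior (P : Pretraining Z O G Ω) {c : ℝ}
    (hc : ∀ z z' : Z, P.prior z' / P.prior z ≤ ENNReal.ofReal c) : 1 ≤ c := by
  obtain ⟨z, hz⟩ := P.prior.support_nonempty
  have := hc z z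
  rwa [ENNReal.div_self ((PMF.mem_support_iff _ _).1 hz) (PMF.apply_ne_top _ _),
    ENNReal.one_le_ofReal] at this

theorem Pretraining.prior_le (P : Pretraining Z O G Ω) {c : ℝ}
    (hc : ∀ z z' : Z, P.prior z' / P.prior z ≤ ENNReal.ofReal c) (z z' : Z) :
    P.prior z' ≤ ENNReal.ofReal c * P.prior z :=
  (ENNReal.div_le_iff (P.prior_ne_zero hc z) (PMF.apply_ne_top _ _)).1 (hc z z')

/-- A product of averages of experts puts at least the power of a posterior weight on every
joint subgoal of an expert. -/
theorem Policy.tsum_joint_tsub_le (π π' : Policy O G Ω) {h : ℕ} (τ : Traj O (∀ k, G k) h) (w : Ω)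
    {q : ℝ≥0∞} (hq : q ≤ 1) (hle : ∀ k g, π h k τ w g * q ≤ π' h k τ w g) :
    ∑' g, (π.joint h τ w g - π'.joint h τ w g) ≤ K * (1 - q) := by
  have h1 : ∀ g, π.joint h τ w g - π'.joint h τ w g ≤ π.joint h τ w g * (K * (1 - q)) := by
    intro g
    have h2 : π.joint h τ w g * q ^ K ≤ π'.joint h τ w g := by
      refine le_trans (le_of_eq ?_) (Finset.prod_le_prod' fun k _ => hle k (g k))
      rw [Finset.prod_mul_distrib, Finset.prod_const, Finset.card_univ, Fintype.card_fin]
      rfl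
    rw [tsub_le_iff_left]
    calc π.joint h τ w g = π.joint h τ w g * 1 := (mul_one _).symm
      _ ≤ π.joint h τ w g * (q ^ K + K * (1 - q)) := by
          gcongr; exact one_le_pow_add_mul_one_sub q hq K
      _ = π.joint h τ w g * q ^ K + π.joint h τ w g * (K * (1 - q)) := mul_add _ _ _
      _ ≤ _ := by gcongr
  refine (ENNReal.tsum_le_tsum h1).trans (le_of_eq ?_)
  rw [ENNReal.tsum_mul_right, π.tsum_joint, one_mul]

theorem Pretraining.Covers.behavior_mass_ne_zero {P : Pretraining Z O G Ω} {e : ExpPolicy O G} (hcov : P.Covers e) (w : Ω) {n : ℕ}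
    {τ : Traj O (∀ k, G k) n} (hm : (e.toPolicy : Policy O G Ω).mass w τ ≠ 0) :
    P.behavior.mass w τ ≠ 0 :=
  Finset.prod_ne_zero_iff.2 fun i hi => Finset.prod_ne_zero_iff.2 fun k hk =>
    hcov _ _ _ _ _ (Or.inl (Finset.prod_ne_zero_iff.1 (Finset.prod_ne_zero_iff.1 hm i hi) k hk))

variable [MeasurableSpace S] [∀ k, MeasurableSpace (A k)] [MeasurableSpace O]

/-- The part of the prompt mass that depends on the environment. -/
def HMG.promptEnvMass (M : HMG K Z S A O G Ω) {H t n : ℕ} (z : Z)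
    (past : Fin t → Traj O (∀ k, G k) (H - 1)) (τ : Traj O (∀ k, G k) n) : ℝ≥0∞ :=
  (∏ i, M.envMass M.emission z (past i)) * M.envMass M.emission z τ

variable [Countable O] [MeasurableSingletonClass O]

section Perfect

variable {H Tp T : ℕ} {M : HMG K Z S A O G Ω} {P : Pretraining Z O G Ω} {rep : ℕ → Kernel S O}
  {L : LanguageModel H O G Ω} {e : ExpPolicy O G} {c η ε : ℝ} {ω : ℕ → Ω}

theorem Perfect.model_eq_sum [Fintype Z] (hL : Perfect P M H Tp rep L) (t : Fin Tp) (h : Fin H)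
    (pt : Prompt H O G Ω t h) (hpt : P.prob M H Tp pt.event ≠ 0) (k : Fin K) (g : G k) :
    L t h pt k g = ∑ z, P.expert z h k pt.traj pt.task g *
      P.condProb M H Tp (latentEvent z) pt.event := by
  rw [hL.model t h pt hpt, P.condProb_label]

/-- The prompts of the Planner that occur in pretraining. -/
theorem Pretraining.prob_prompt_ne_zero [Fintype Z] (htask : ∀ t < T, P.taskPrior (ω t) ≠ 0)
    {z : Z} (hz : P.prior z ≠ 0) {t : Fin Tp} (htT : t < T) {h : Fin H}
    {past : Fin t → Traj O (∀ k, G k) (H - 1)}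
    (hpast : ∀ i : Fin t, P.behavior.mass (ω i) (past i) ≠ 0 ∧
      M.envMass M.emission z (past i) ≠ 0) {τ : Traj O (∀ k, G k) h}
    (hb : P.behavior.mass (ω t) τ ≠ 0) (hτ : M.envMass M.emission z τ ≠ 0) :
    P.prob M H Tp (⟨fun i => (ω i, past i), ω t, τ⟩ : Prompt H O G Ω t h).event ≠ 0 := by
  rw [P.prob_prompt]
  intro h0
  refine mul_ne_zero hz (mul_ne_zero (Finset.prod_ne_zero_iff.2 fun i _ => ?_) ?_)
    (Finset.sum_eq_zero_iff.1 h0 z (Finset.mem_univ z))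
  · exact mul_ne_zero (htask i (i.isLt.trans htT)) (mul_ne_zero (hpast i).1 (hpast i).2)
  · exact mul_ne_zero (htask t htT) (mul_ne_zero hb hτ)

/-- Induction along the episode. If the prefix can occur in pretraining, the model is the posterior
mean there, so a subgoal it may recommend is one that some expert may play, and coverage extends the
prefix. -/
theorem Perfect.behavior_mass_recommend_ne_zero [Fintype Z] (hL : Perfect P M H Tp rep L)
    (hcov : P.Covers e) (hT : T ≤ Tp) (htask : ∀ t < T, P.taskPrior (ω t) ≠ 0)
    {z : Z} (hz : P.prior z ≠ 0) {t : ℕ} (ht : t < T) {past : Fin t → Traj O (∀ k, G k) (H - 1)}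
    (hpast : ∀ i : Fin t, P.behavior.mass (ω i) (past i) ≠ 0 ∧
      M.envMass M.emission z (past i) ≠ 0) {n : ℕ} (hn : n < H) (τ : Traj O (∀ k, G k) n)
    (hτ : M.envMass M.emission z τ ≠ 0) (hm : (L.recommend ω t past).mass (ω t) τ ≠ 0) :
    P.behavior.mass (ω t) τ ≠ 0 := by
  induction n with
  | zero => simp [Policy.mass_zero]
  | succ n ih =>
    obtain ⟨σ, g, o, rfl⟩ := τ.exists_eq_snoc
    rw [Policy.mass_snoc] at hm ⊢
    have hσ : M.envMass M.emission z σ ≠ 0 := fun h0 =>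
      hτ (le_antisymm ((M.envMass_snoc_le z σ g o).trans h0.le) zero_le)
    have hb := ih (by omega) σ hσ (left_ne_zero_of_mul hm)
    refine mul_ne_zero hb (Finset.prod_ne_zero_iff.2 fun k _ => ?_)
    have hk := Finset.prod_ne_zero_iff.1 (right_ne_zero_of_mul hm) k (Finset.mem_univ k)
    have hpt := Pretraining.prob_prompt_ne_zero (M := M) (t := ⟨t, ht.trans_le hT⟩)
      (h := ⟨n, by omega⟩) htask hz ht hpast hb hσ
    have hk' := hL.model_eq_sum ⟨t, ht.trans_le hT⟩ ⟨n, by omega⟩ _ hpt k (g k)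
    obtain ⟨y, -, hy⟩ := Finset.exists_ne_zero_of_sum_ne_zero (hk'.symm.trans_ne hk)
    exact hcov n k σ (ω t) (g k) (Or.inr ⟨y, left_ne_zero_of_mul hy⟩)

/-- The histories that the Planner can produce can occur in pretraining. -/
theorem Perfect.history_ne_zero [Fintype Z] (hL : Perfect P M H Tp rep L)
    (hcov : P.Covers e) (hH : 1 ≤ H) (hT : T ≤ Tp) (htask : ∀ t < T, P.taskPrior (ω t) ≠ 0)
    {z : Z} (hz : P.prior z ≠ 0) {t : ℕ} (ht : t ≤ T) {past : Fin t → Traj O (∀ k, G k) (H - 1)}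
    (hm : M.historyMass H rep L e ε z ω t past ≠ 0) (i : Fin t) :
    P.behavior.mass (ω i) (past i) ≠ 0 ∧ M.envMass M.emission z (past i) ≠ 0 := by
  rw [M.historyMass_eq hH hL.reporter] at hm
  obtain ⟨i, hi⟩ := i
  -- The recommendation in episode `i` is controlled only once all earlier episodes are known to be
  -- possible in pretraining.
  induction i using Nat.strong_induction_on with
  | _ i ih =>
    have h1 := Finset.prod_ne_zero_iff.1 hm ⟨i, hi⟩ (Finset.mem_univ _)
    have hW := right_ne_zero_of_mul h1
    refine ⟨?_, hW⟩
    obtain ⟨I, -, hI⟩ := Finset.exists_ne_zero_of_sum_ne_zero (left_ne_zero_of_mul h1)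
    have hI := right_ne_zero_of_mul hI
    cases I with
    | true => exact hcov.behavior_mass_ne_zero _ hI
    | false =>
      exact hL.behavior_mass_recommend_ne_zero hcov hT htask hz (hi.trans_le ht)
        (fun j => ih j j.isLt (j.isLt.trans hi)) (by omega) _ hW hI

/-- The expected gap between expert and recommendation at one prompt. -/
theorem Perfect.promptEnvMass_mul_le [Fintype Z] [DecidableEq Z] (hL : Perfect P M H Tp rep L)
    (hc : ∀ z z' : Z, P.prior z' / P.prior z ≤ ENNReal.ofReal c) (hT : T ≤ Tp)
    (htask : ∀ t < T, P.taskPrior (ω t) ≠ 0) (z : Z) {t : ℕ} (ht : t < T)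
    {past : Fin t → Traj O (∀ k, G k) (H - 1)}
    (hpast : ∀ i : Fin t, P.behavior.mass (ω i) (past i) ≠ 0 ∧
      M.envMass M.emission z (past i) ≠ 0) {n : ℕ} (hn : n < H) (τ : Traj O (∀ k, G k) n)
    (hτ : M.envMass M.emission z τ ≠ 0) (hb : P.behavior.mass (ω t) τ ≠ 0) :
    M.promptEnvMass z past τ *
      ∑' g, ((P.expert z).joint n τ (ω t) g - (L.recommend ω t past).joint n τ (ω t) g) ≤
    K * ∑ z' ∈ Finset.univ.erase z, ENNReal.ofReal c *
      geoMean (M.promptEnvMass z past τ) (M.promptEnvMass z' past τ) := by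
  let t' : Fin Tp := ⟨t, ht.trans_le hT⟩
  let h' : Fin H := ⟨n, hn⟩
  let pt : Prompt H O G Ω t' h' := ⟨fun i => (ω i, past i), ω t, τ⟩
  have hpt : P.prob M H Tp pt.event ≠ 0 :=
    Pretraining.prob_prompt_ne_zero (M := M) (t := t') (h := h') htask (P.prior_ne_zero hc z) ht
      hpast hb hτ
  -- The part of the prompt mass common to all latent variables; it cancels in the posterior.
  let B : ℝ≥0∞ := (∏ i : Fin t, P.taskPrior (ω i) * P.behavior.mass (ω i) (past i)) *
    (P.taskPrior (ω t) * P.behavior.mass (ω t) τ)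
  have hA : ∀ y, P.promptMass M y pt = P.prior y * (B * M.promptEnvMass y past τ) := by
    intro y
    simp only [Pretraining.promptMass, Pretraining.taskTrajMass, HMG.promptEnvMass, pt, B,
      ← mul_assoc, Finset.prod_mul_distrib]
    ring
  have hS := P.prob_prompt M pt
  have hStop : P.prob M H Tp pt.event ≠ ∞ := by
    rw [hS]
    exact ENNReal.sum_ne_top.2 fun y _ => P.promptMass_ne_top M y pt
  have hq : P.condProb M H Tp (latentEvent z) pt.event = P.promptMass M z pt /
    P.prob M H Tp pt.event := P.condProb_latent M pt z
  have hq1 : P.condProb M H Tp (latentEvent z) pt.event ≤ 1 := by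
    rw [hq]
    refine ENNReal.div_le_of_le_mul ?_
    rw [one_mul, hS]
    exact Finset.single_le_sum (f := fun y => P.promptMass M y pt) (fun _ _ => zero_le)
      (Finset.mem_univ z)
  have h1 := Policy.tsum_joint_tsub_le (P.expert z) (L.recommend ω t past) τ (ω t) hq1
    fun k g => by
      have h2 : L.recommend ω t past n k τ (ω t) g = _ := hL.model_eq_sum t' h' pt hpt k g
      rw [h2]
      exact Finset.single_le_sum (f := fun y => P.expert y n k τ (ω t) g *
        P.condProb M H Tp (latentEvent y) pt.event) (fun _ _ => zero_le) (Finset.mem_univ z)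
  refine (mul_le_mul_right h1 _).trans ?_
  rw [mul_left_comm]
  refine mul_le_mul_right ?_ _
  rw [hq, hA]
  rw [hS] at hpt hStop ⊢
  simp only [hA] at hpt hStop ⊢
  exact envMass_mul_one_sub_posterior_le (ENNReal.one_le_ofReal.2 (P.one_le_of_prior hc))
    (P.prior_le hc) hpt hStop z

/-- The expected distance between the expert and the recommended policy in episode `t`. -/
theorem Perfect.tsum_history_mul_gap_le [Fintype Z] (hL : Perfect P M H Tp rep L)
    (hcov : P.Covers e) (hη : M.Distinguishable H e η)
    (hc : ∀ z z' : Z, P.prior z' / P.prior z ≤ ENNReal.ofReal c) (hH : 1 ≤ H) (hT : T ≤ Tp)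
    (htask : ∀ t < T, P.taskPrior (ω t) ≠ 0) (h0 : 0 ≤ ε) (h1 : ε ≤ 1) (z : Z) {t : ℕ}
    (ht : t < T) :
    ∑' past, M.historyMass H rep L e ε z ω t past * ∑' τ : Traj O (∀ k, G k) (H - 1),
      M.envMass M.emission z τ *
        ((P.expert z).mass (ω t) τ - (L.recommend ω t past).mass (ω t) τ) ≤
    (H - 1 : ℕ) * (K * ((Fintype.card Z - 1 : ℕ) * (ENNReal.ofReal c *
      ENNReal.ofReal (1 - ε * η) ^ t))) := by
  classical
  let Q : (Fin t → Traj O (∀ k, G k) (H - 1)) → ℝ≥0∞ := fun past =>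
    ∏ i : Fin t, plannerMass L e ε ω i (fun j => past (Fin.castLE i.isLt.le j)) (past i)
  have hQ : ∀ past, M.historyMass H rep L e ε z ω t past =
      Q past * ∏ i, M.envMass M.emission z (past i) := fun past => by
    rw [M.historyMass_eq hH hL.reporter, Finset.prod_mul_distrib]
  -- Each past episode contributes a factor `1 - ε * η`; the current partial one, played by the
  -- recommendation, contributes at most `1`.
  have hbc : ∀ n, ∀ z' ∈ Finset.univ.erase z, ∑' past : Fin t → Traj O (∀ k, G k) (H - 1),
      ∑' τ : Traj O (∀ k, G k) n, Q past * (L.recommend ω t past).mass (ω t) τ *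
        geoMean (M.promptEnvMass z past τ) (M.promptEnvMass z' past τ) ≤
      ENNReal.ofReal (1 - ε * η) ^ t := by
    intro n z' hz'
    have hne : z ≠ z' := (Finset.ne_of_mem_erase hz').symm
    refine le_trans (ENNReal.tsum_le_tsum fun past => ?_) (tsum_adaptive_le
      (fun t past τ => plannerMass L e ε ω t past τ * geoMean (M.envMass M.emission z τ)
        (M.envMass M.emission z' τ)) _
      (tsum_plannerMass_mul_geoMean_le hη (hη.eta_le_one (ω 0) hne) L h0 h1 ω hne) t)
    rw [Finset.prod_mul_distrib, ← geoMean_prod]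
    refine le_trans (le_of_eq ?_) (mul_le_of_le_one_right zero_le
      (M.tsum_mass_mul_geoMean_le_one z z' (L.recommend ω t past) (ω t) n))
    rw [← ENNReal.tsum_mul_left]
    refine tsum_congr fun τ => ?_
    simp only [HMG.promptEnvMass, geoMean_mul, Q]
    ring
  calc _ ≤ ∑' past, M.historyMass H rep L e ε z ω t past * ∑ h ∈ Finset.range (H - 1),
        ∑' τ : Traj O (∀ k, G k) h, (L.recommend ω t past).mass (ω t) τ *
          M.envMass M.emission z τ * ∑' g, ((P.expert z).joint h τ (ω t) g -
            (L.recommend ω t past).joint h τ (ω t) g) :=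
        ENNReal.tsum_le_tsum fun past => mul_le_mul_right (M.tsum_envMass_mul_tsub_le _ _ _ _ _) _
    _ ≤ ∑' past, ∑ h ∈ Finset.range (H - 1), ∑' τ : Traj O (∀ k, G k) h,
        K * ∑ z' ∈ Finset.univ.erase z, ENNReal.ofReal c *
          (Q past * (L.recommend ω t past).mass (ω t) τ *
            geoMean (M.promptEnvMass z past τ) (M.promptEnvMass z' past τ)) := by
        refine ENNReal.tsum_le_tsum fun past => ?_
        rw [Finset.mul_sum]
        refine Finset.sum_le_sum fun n hn => ?_
        rw [← ENNReal.tsum_mul_left]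
        refine ENNReal.tsum_le_tsum fun τ => ?_
        have hn : n < H := by have := Finset.mem_range.1 hn; omega
        -- Terms of zero weight are dropped first: there the prompt may have pretraining probability
        -- zero and the model is arbitrary.
        by_cases h2 : M.historyMass H rep L e ε z ω t past = 0
        · simp [h2]
        by_cases h3 : (L.recommend ω t past).mass (ω t) τ = 0
        · simp [h3]
        by_cases h4 : M.envMass M.emission z τ = 0
        · simp [h4]
        have hz := P.prior_ne_zero hc z
        have hpast := hL.history_ne_zero hcov hH hT htask hz ht.le h2
        have hb := hL.behavior_mass_recommend_ne_zero hcov hT htask hz ht hpast hn τ h4 h3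
        have h5 := hL.promptEnvMass_mul_le hc hT htask z ht hpast hn τ h4 hb
        calc _ = Q past * (L.recommend ω t past).mass (ω t) τ * (M.promptEnvMass z past τ *
              ∑' g, ((P.expert z).joint n τ (ω t) g -
                (L.recommend ω t past).joint n τ (ω t) g)) := by
              rw [hQ, HMG.promptEnvMass]; ring
          _ ≤ _ := mul_le_mul_right h5 _
          _ = _ := by
              simp only [Finset.mul_sum]
              exact Finset.sum_congr rfl fun z' _ => by ring
    _ = ∑ h ∈ Finset.range (H - 1), K * ∑ z' ∈ Finset.univ.erase z, ENNReal.ofReal c *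
        ∑' past, ∑' τ : Traj O (∀ k, G k) h, Q past * (L.recommend ω t past).mass (ω t) τ *
            geoMean (M.promptEnvMass z past τ) (M.promptEnvMass z' past τ) := by
        rw [Summable.tsum_finsetSum fun _ _ => ENNReal.summable]
        refine Finset.sum_congr rfl fun n _ => ?_
        simp only [ENNReal.tsum_mul_left]
        congr 1
        simp only [Summable.tsum_finsetSum fun _ _ => ENNReal.summable, ENNReal.tsum_mul_left]
    _ ≤ ∑ h ∈ Finset.range (H - 1), K * ∑ z' ∈ Finset.univ.erase z, ENNReal.ofReal c *
        ENNReal.ofReal (1 - ε * η) ^ t :=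
        Finset.sum_le_sum fun n _ => mul_le_mul_right (Finset.sum_le_sum fun z' hz' =>
          mul_le_mul_right (hbc n z' hz') _) _
    _ = _ := by
        simp [Finset.card_erase_of_mem]

end Perfect

end Regret

/-! ### Balancing exploration and exploitation -/

section Final

/-- After `⌈log a / u⌉` terms the factor `a` is used up, since `1 - u ≤ exp (-u)`; the rest is a
plain geometric series. Thus `a` costs only its logarithm, and `u ≤ 1` absorbs the rounding. -/
theorem sum_min_one_geometric_le {a u : ℝ} (ha : 1 ≤ a) (hu : 0 < u) (hu1 : u ≤ 1) (T : ℕ) :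
    ∑ t ∈ Finset.range T, min 1 (a * (1 - u) ^ t) ≤ (Real.log a + 2) / u := by
  set n := ⌈Real.log a / u⌉₊
  have hx0 : 0 ≤ 1 - u := by linarith
  have hlog : 0 ≤ Real.log a / u := div_nonneg (Real.log_nonneg ha) hu.le
  have han : a * (1 - u) ^ n ≤ 1 := by
    have h1 : (1 - u) ^ n ≤ Real.exp (-u) ^ n :=
      pow_le_pow_left₀ hx0 (Real.one_sub_le_exp_neg u) n
    have h2 : Real.log a ≤ n * u := (div_le_iff₀ hu).1 (Nat.le_ceil _)
    calc a * (1 - u) ^ n ≤ Real.exp (Real.log a) * Real.exp (-u) ^ n := by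
          rw [Real.exp_log (by linarith)]; gcongr
      _ = Real.exp (Real.log a - n * u) := by
          rw [← Real.exp_nat_mul, ← Real.exp_add]; ring_nf
      _ ≤ 1 := Real.exp_le_one_iff.2 (by linarith)
  have hnn : ∀ t, 0 ≤ min 1 (a * (1 - u) ^ t) := fun t =>
    le_min zero_le_one (mul_nonneg (by linarith) (pow_nonneg hx0 t))
  have hgeo : ∑ t ∈ Finset.range T, (1 - u) ^ t ≤ 1 / u := by
    have h1 := mul_neg_geom_sum (1 - u) T
    rw [sub_sub_cancel] at h1
    rw [le_div_iff₀ hu, mul_comm, h1]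
    linarith [pow_nonneg hx0 T]
  calc ∑ t ∈ Finset.range T, min 1 (a * (1 - u) ^ t)
      ≤ ∑ t ∈ Finset.range (n + T), min 1 (a * (1 - u) ^ t) :=
        Finset.sum_le_sum_of_subset_of_nonneg (Finset.range_mono (by omega)) fun t _ _ => hnn t
    _ = ∑ t ∈ Finset.range n, min 1 (a * (1 - u) ^ t) +
        ∑ t ∈ Finset.range T, min 1 (a * (1 - u) ^ (n + t)) := Finset.sum_range_add _ _ _
    _ ≤ ∑ t ∈ Finset.range n, 1 + ∑ t ∈ Finset.range T, (1 - u) ^ t := by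
        refine add_le_add (Finset.sum_le_sum fun t _ => min_le_left _ _)
          (Finset.sum_le_sum fun t _ => (min_le_right _ _).trans ?_)
        rw [pow_add, ← mul_assoc]
        exact mul_le_of_le_one_left (pow_nonneg hx0 t) han
    _ ≤ (Real.log a / u + 1) + 1 / u := by
        refine add_le_add ?_ hgeo
        simpa using (Nat.ceil_lt_add_one hlog).le
    _ ≤ (Real.log a + 2) / u := by
        have : 1 ≤ 1 / u := by rw [le_div_iff₀ hu]; linarith
        rw [add_div, show (2 : ℝ) / u = 1 / u + 1 / u by ring]
        linarith

theorem exploreProb_nonneg {H K T N : ℕ} {c η : ℝ} :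
    0 ≤ exploreProb H K T N c η := by
  unfold exploreProb
  rw [← Real.sqrt_eq_rpow]
  exact le_min zero_le_one (Real.sqrt_nonneg _)

/-- Exploration and exploitation balance for the exploration probability of the Planner. -/
theorem sum_explore_exploit_le {H K T N : ℕ} {c η : ℝ} (hH : 1 ≤ H) (hK : 1 ≤ K) (hT : 1 ≤ T)
    (hN : 1 ≤ N) (hc : 1 ≤ c) (hη : 0 < η) {x : ℕ → ℝ} (hx1 : ∀ t < T, x t ≤ 1)
    (hN1 : N = 1 → ∀ t < T, x t ≤ 0) (hη1 : 2 ≤ N → η ≤ 1)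
    (hN2 : 2 ≤ N → ∀ t < T, x t ≤
      H * K * ((N - 1 : ℕ) * c * (1 - exploreProb H K T N c η * η) ^ t)) :
    ∑ t ∈ Finset.range T, (exploreProb H K T N c η * H + H * x t) ≤
      5 * ((H : ℝ) ^ (3 / 2 : ℝ) * √(T * K / η * Real.log (c * N * √T))) := by
  have hH' : (1 : ℝ) ≤ H := by exact_mod_cast hH
  have hK' : (1 : ℝ) ≤ K := by exact_mod_cast hK
  have hT' : (1 : ℝ) ≤ T := by exact_mod_cast hT
  have hN' : (1 : ℝ) ≤ N := by exact_mod_cast hN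
  have hsT : 1 ≤ √(T : ℝ) := Real.one_le_sqrt.2 hT'
  have hcN : c * N ≤ c * N * √T := le_mul_of_one_le_right (by positivity) hsT
  have hcN1 : 1 ≤ c * N := one_le_mul_of_one_le_of_one_le hc hN'
  set l := Real.log (c * N * √T) with hl
  have hl0 : 0 ≤ l := Real.log_nonneg (hcN1.trans hcN)
  set s := √(H * K * l / (T * η)) with hs
  have hs0 : 0 ≤ s := Real.sqrt_nonneg _
  have hss : s ^ 2 = H * K * l / (T * η) := Real.sq_sqrt (by positivity)
  have hε : exploreProb H K T N c η = min 1 s := by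
    rw [exploreProb, ← Real.sqrt_eq_rpow]
  have hR : (H : ℝ) ^ (3 / 2 : ℝ) * √(T * K / η * l) = H * T * s := by
    rw [show (3 / 2 : ℝ) = 1 + 1 / 2 by norm_num, Real.rpow_add (by linarith), Real.rpow_one,
      ← Real.sqrt_eq_rpow, mul_assoc, mul_assoc, ← Real.sqrt_mul (by linarith), hs]
    congr 1
    rw [← Real.sqrt_sq (show (0 : ℝ) ≤ T by linarith), ← Real.sqrt_mul (by positivity),
      Real.sqrt_sq (show (0 : ℝ) ≤ T by linarith)]
    congr 1
    field_simp
  rw [hR, hε]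
  rw [hε] at hN2
  rw [Finset.sum_add_distrib, Finset.sum_const, Finset.card_range, nsmul_eq_mul, ← Finset.mul_sum]
  have h0 : 0 ≤ H * T * s := by positivity
  -- If the cap is active, the trivial bound `2 * H * T` already suffices.
  rcases le_total 1 s with h1 | h1
  · rw [min_eq_left h1, one_mul]
    have : ∑ t ∈ Finset.range T, x t ≤ T := by
      simpa using Finset.sum_le_sum fun t ht => hx1 t (Finset.mem_range.1 ht)
    have h2 : (H : ℝ) * ∑ t ∈ Finset.range T, x t ≤ H * T :=
      mul_le_mul_of_nonneg_left this (by linarith)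
    have h3 : (H : ℝ) * T ≤ H * T * s := le_mul_of_one_le_right (by positivity) h1
    linarith
  · rw [min_eq_right h1] at hN2 ⊢
    suffices h : (H : ℝ) * ∑ t ∈ Finset.range T, x t ≤ 4 * (H * T * s) by linarith
    -- With one latent variable there is nothing to learn. This case is separate because `l`, hence
    -- `s`, may vanish, and the argument below divides by `s`.
    rcases hN.eq_or_lt with hN3 | hN3
    · have : ∑ t ∈ Finset.range T, x t ≤ 0 :=
        Finset.sum_nonpos fun t ht => hN1 hN3.symm t (Finset.mem_range.1 ht)
      nlinarith
    · have hη1 := hη1 hN3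
      have hN2 := hN2 hN3
      have hN4 : (2 : ℝ) ≤ N := by exact_mod_cast hN3
      have hNc : ((N - 1 : ℕ) : ℝ) = N - 1 := by push_cast [hN]; ring
      have hl2 : Real.log 2 ≤ l := Real.log_le_log (by norm_num)
        (le_trans (by nlinarith) hcN)
      -- Makes `2 ≤ 3 * l`, so that `log a + 2 ≤ 4 * l`. With the one unit for exploration this
      -- gives the constant `5`.
      have hl3 : (2 : ℝ) / 3 < l := by linarith [Real.log_two_gt_d9]
      have hspos : 0 < s := Real.sqrt_pos.2 (by positivity)
      set a : ℝ := (N - 1 : ℕ) * c with ha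
      have ha1 : 1 ≤ a := by rw [ha, hNc]; nlinarith
      have hal : Real.log a ≤ l := Real.log_le_log (by linarith)
        (le_trans (by rw [ha, hNc]; nlinarith) hcN)
      -- As `x t ≤ 1 ≤ H * K`, the factor `H * K` can stand outside the minimum and stays out of the
      -- logarithm.
      have hxt : ∀ t ∈ Finset.range T, x t ≤ H * K * min 1 (a * (1 - s * η) ^ t) := by
        intro t ht
        rw [mul_min_of_nonneg _ _ (by positivity), mul_one]
        exact le_min ((hx1 t (Finset.mem_range.1 ht)).trans
          (one_le_mul_of_one_le_of_one_le hH' hK')) (hN2 t (Finset.mem_range.1 ht))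
      have hsum : ∑ t ∈ Finset.range T, x t ≤ H * K * ((Real.log a + 2) / (s * η)) := by
        refine (Finset.sum_le_sum hxt).trans ?_
        rw [← Finset.mul_sum]
        exact mul_le_mul_of_nonneg_left
          (sum_min_one_geometric_le ha1 (by positivity) (by nlinarith) T) (by positivity)
      have h4 : (Real.log a + 2) / (s * η) ≤ 4 * l / (s * η) := by gcongr; linarith
      calc (H : ℝ) * ∑ t ∈ Finset.range T, x t ≤ H * (H * K * (4 * l / (s * η))) := by
            gcongr; exact hsum.trans (by gcongr)
        _ = 4 * (H * T * ((H * K * l / (T * η)) / s)) := by field_simp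
        _ = 4 * (H * T * s) := by rw [← hss]; field_simp

variable {K : ℕ} {Z S : Type*} {A : Fin K → Type*} {O : Type*} {G : Fin K → Type*} {Ω : Type*}
  [MeasurableSpace S] [∀ k, MeasurableSpace (A k)] [MeasurableSpace O]
  [Countable O] [MeasurableSingletonClass O]

/-- The regret is at most the cost of exploration plus the cost of the gaps between the optimal and
the recommended policies. -/
theorem HMG.regret_le (M : HMG K Z S A O G Ω) {H : ℕ} (hH : 1 ≤ H) (opt : Z → Policy O G Ω)
    {rep : ℕ → Kernel S O} (hrep : ∀ h < H, ∀ s, rep h s = M.emission h s)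
    (L : LanguageModel H O G Ω) (e : ExpPolicy O G) {ε : ℝ} (h0 : 0 ≤ ε) (h1 : ε ≤ 1) (z : Z)
    (ω : ℕ → Ω) (T : ℕ) :
    M.regret H opt rep L e ε z ω T ≤ ∑ t ∈ Finset.range T, (ε * H + H *
      (∑' past, M.historyMass H rep L e ε z ω t past * ∑' τ : Traj O (∀ k, G k) (H - 1),
        M.envMass M.emission z τ *
          ((opt z).mass (ω t) τ - (L.recommend ω t past).mass (ω t) τ)).toReal) := by
  refine Finset.sum_le_sum fun t _ => ?_
  set D : (Fin t → Traj O (∀ k, G k) (H - 1)) → ℝ≥0∞ := fun past =>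
    ∑' τ : Traj O (∀ k, G k) (H - 1), M.envMass M.emission z τ *
      ((opt z).mass (ω t) τ - (L.recommend ω t past).mass (ω t) τ) with hD
  have hD1 : ∀ past, D past ≤ 1 := fun past => M.tsum_envMass_mul_tsub_le_one _ _ _ _ _
  have hm1 := M.tsum_historyMass_le_one hH hrep L e h0 h1 z ω t
  have hmtop : ∑' past, M.historyMass H rep L e ε z ω t past ≠ ∞ :=
    ne_top_of_le_ne_top ENNReal.one_ne_top hm1
  have hmDtop : ∑' past, M.historyMass H rep L e ε z ω t past * D past ≠ ∞ :=
    ne_top_of_le_ne_top hmtop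
      (ENNReal.tsum_le_tsum fun past => mul_le_of_le_one_right zero_le (hD1 past))
  have sm := ENNReal.summable_toReal hmtop
  have smD := ENNReal.summable_toReal hmDtop
  have hm1' : ∑' past, (M.historyMass H rep L e ε z ω t past).toReal ≤ 1 := by
    rw [← ENNReal.tsum_toReal_eq (ENNReal.ne_top_of_tsum_ne_top hmtop)]
    exact ENNReal.toReal_le_of_le_ofReal zero_le_one (by simpa using hm1)
  have hle : ∀ past, (M.historyMass H rep L e ε z ω t past).toReal * ∑ I : Bool, coin ε I *
      (M.value H z (opt z) (ω t) - M.value H z (plannerPolicy L e ω t past I) (ω t)) ≤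
      (M.historyMass H rep L e ε z ω t past).toReal * (ε * H) +
        H * (M.historyMass H rep L e ε z ω t past * D past).toReal := by
    intro past
    rw [ENNReal.toReal_mul, mul_left_comm (H : ℝ), ← mul_add]
    refine mul_le_mul_of_nonneg_left ?_ ENNReal.toReal_nonneg
    simp only [Fintype.sum_bool, coin, if_true, Bool.false_eq_true, if_false, plannerPolicy]
    have hexp : M.value H z (opt z) (ω t) - M.value H z e.toPolicy (ω t) ≤ H := by
      refine (M.value_sub_value_le hH z _ _ _).trans (mul_le_of_le_one_right (Nat.cast_nonneg H) ?_)
      exact ENNReal.toReal_le_of_le_ofReal zero_le_one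
        (by simpa using M.tsum_envMass_mul_tsub_le_one z _ _ _ _)
    have hrec := M.value_sub_value_le hH z (opt z) (L.recommend ω t past) (ω t)
    refine add_le_add (mul_le_mul_of_nonneg_left hexp h0)
      ((mul_le_mul_of_nonneg_left hrec (by linarith)).trans ?_)
    exact mul_le_of_le_one_left (by positivity) (by linarith)
  by_cases hs : Summable fun past => (M.historyMass H rep L e ε z ω t past).toReal *
      ∑ I : Bool, coin ε I *
        (M.value H z (opt z) (ω t) - M.value H z (plannerPolicy L e ω t past I) (ω t))
  · refine (hs.tsum_le_tsum hle ((sm.mul_right _).add (smD.mul_left _))).trans ?_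
    rw [(sm.mul_right _).tsum_add (smD.mul_left _), tsum_mul_right, tsum_mul_left,
      ← ENNReal.tsum_toReal_eq (ENNReal.ne_top_of_tsum_ne_top hmDtop)]
    exact add_le_add (mul_le_of_le_one_left (by positivity) hm1') le_rfl
  -- A divergent `tsum` is `0` by convention, and the bound is nonnegative.
  · rw [tsum_eq_zero_of_not_summable hs]
    positivity

end Final

end CoopHMG

end

/-! ### The corollary -/

open CoopHMG in
theorem corollaryB4 :
    ∃ (C : ℝ) (p : ℕ),
      ∀ {K H Tp T : ℕ} {Z S : Type*} {A : Fin K → Type*} {O : Type*} {G : Fin K → Type*}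
        {Ω : Type*} [Fintype Z] [MeasurableSpace S] [∀ k, MeasurableSpace (A k)]
        [Countable O] [MeasurableSpace O] [MeasurableSingletonClass O]
        (M : HMG K Z S A O G Ω) (P : Pretraining Z O G Ω) (rep : ℕ → Kernel S O)
        (L : LanguageModel H O G Ω) (e : ExpPolicy O G) (c η : ℝ) (ω : ℕ → Ω),
        1 ≤ K → 1 ≤ H → 1 ≤ T → T ≤ Tp →
        M.IsOptimal H P.expert →
        Perfect P M H Tp rep L →
        (∀ z z' : Z, P.prior z' / P.prior z ≤ ENNReal.ofReal c) →
        M.Distinguishable H e η →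
        P.Covers e → (∀ t < T, P.taskPrior (ω t) ≠ 0) →
        (∀ (t : Fin Tp) (h : Fin H) (pt : Prompt H O G Ω t h),
          P.prob M H Tp pt.event ≠ 0 → ∀ g : ∀ k, G k,
            ∏ k, L t h pt k (g k) =
              ∏ k, ∑ z : Z, P.expert z h k pt.traj pt.task (g k) *
                P.condProb M H Tp (latentEvent z) pt.event) ∧
        ∀ z : Z,
          M.regret H P.expert rep L e (exploreProb H K T (Fintype.card Z) c η) z ω T ≤
            C * ((H : ℝ) ^ (3 / 2 : ℝ) *
              √(T * K / η * Real.log (c * Fintype.card Z * √T))) * (1 + Real.log T) ^ p := by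
  -- The exponent `0` suffices: no logarithm of `T` is needed beyond the one under the root.
  refine ⟨5, 0, ?_⟩
  intro K H Tp T Z S A O G Ω _ _ _ _ _ _ M P rep L e c η ω hK hH hT hTp _ hL hc hη hcov htask
  refine ⟨fun t h pt hpt g => Finset.prod_congr rfl fun k _ => hL.model_eq_sum t h pt hpt k (g k),
    fun z => ?_⟩
  set N := Fintype.card Z with hNdef
  set ε := exploreProb H K T N c η with hε
  have h0 : 0 ≤ ε := exploreProb_nonneg
  have h1 : ε ≤ 1 := min_le_left _ _
  have hN : 1 ≤ N := Fintype.card_pos_iff.2 ⟨z⟩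
  have hc1 : 1 ≤ c := P.one_le_of_prior hc
  have hη1 : 2 ≤ N → η ≤ 1 := fun h2 => by
    obtain ⟨z₁, z₂, hne⟩ := Fintype.one_lt_card_iff.1 h2
    exact hη.eta_le_one (ω 0) hne
  rw [pow_zero, mul_one]
  refine (M.regret_le hH P.expert hL.reporter L e h0 h1 z ω T).trans ?_
  have hgap := fun (t : ℕ) (ht : t < T) =>
    hL.tsum_history_mul_gap_le hcov hη hc hH hTp htask h0 h1 z ht
  refine sum_explore_exploit_le hH hK hT hN hc1 hη.1 (fun t _ => ?_) (fun hN1 t ht => ?_) hη1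
    (fun hN2 t ht => ?_)
  · refine ENNReal.toReal_le_of_le_ofReal zero_le_one ?_
    rw [ENNReal.ofReal_one]
    refine le_trans (ENNReal.tsum_le_tsum fun past => ?_)
      (M.tsum_historyMass_le_one hH hL.reporter L e h0 h1 z ω t)
    exact mul_le_of_le_one_right zero_le (M.tsum_envMass_mul_tsub_le_one _ _ _ _ _)
  -- For a single latent variable the gap bound carries the factor `N - 1 = 0`.
  · refine ENNReal.toReal_le_of_le_ofReal le_rfl ((hgap t ht).trans ?_)
    rw [← hNdef, hN1]
    simp
  · have hηl := hη1 hN2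
    have hb : 0 ≤ 1 - ε * η := by nlinarith [hη.1]
    refine ENNReal.toReal_le_of_le_ofReal (by positivity) ((hgap t ht).trans ?_)
    rw [ENNReal.ofReal_mul (by positivity), ENNReal.ofReal_mul (by positivity),
      ENNReal.ofReal_mul (by positivity), ENNReal.ofReal_mul (by positivity),
      ENNReal.ofReal_pow hb, ENNReal.ofReal_natCast, ENNReal.ofReal_natCast,
      ENNReal.ofReal_natCast, mul_assoc, mul_assoc (((N - 1 : ℕ) : ℝ≥0∞))]
    gcongr
    omega
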